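/- Let $0<r_1<m$ and $0<r_2<n$, let $\tau,\gamma\in\mathbb R^{m\times r_1}$ and $\theta,\varphi\in\mathbb R^{n\times r_2}$ have full column rank, and let $(E_t)_{t\in\mathbb Z}$ be an $m\times n$ matrix white noise (square integrable, mean zero, uncorrelated over time, constant covariance matrix of $\operatorname{vec}E_t$) whose covariance matrix is positive definite. Assume the Johansen-type $I(1)$ condition for the matrix error correction model (MECM) $$\Delta X_t=\tau\gamma'X_{t-1}\theta\varphi'+E_t ,$$ namely: (i) if $z\in\mathbb C$ and $\det\big((1-z)I_{mn}-z(\varphi\theta'\otimes\tau\gamma')\big)=0$, then $|z|>1$ or $z=1$; (ii) the unit eigenvalue of $I_{mn}+\varphi\theta'\otimes\tau\gamma'$ is semisimple. A matrix-valued process $(Y_t)_{t\in\mathbb Z}$ with square-integrable entries is called $I(0)$ if $Y_t=M+\sum_{l\ge0}C_l(\varepsilon_{t-l})$ in mean square for a constant matrix $M$, a matrix white noise $\varepsilon$ with positive definite covariance, and linear maps $C_l$ that decay exponentially in $l$ with $\sum_l C_l\neq0$; it is called $I(1)$ if $\Delta Y_t$ is $I(0)$. Stationarity is meant in the weak (second-order)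 sense. 1. Let $(X_t)_{t\in\mathbb Z}$ be any process with square-integrable entries that satisfies the MECM almost surely at every $t\in\mathbb Z$ and is non-explosive in the past, i.e. the entries of $\Delta X_t$, $t\le0$, are bounded in mean square. Then the one-sided processes $\gamma'X_t$ and $X_t\theta$ are both $I(1)$ and not $I(0)$, whereas $\gamma'X_t\theta$ is $I(0)$ and stationary. Moreover, only the bilinear combination is stationary: for $B\in\mathbb R^{m\times n}$, the scalar process $\operatorname{tr}(B'X_t)$ is stationary if and only if $B=\gamma C\theta'$ for some $C\in\mathbb R^{r_1\times r_2}$, i.e. if and only if it is a linear combination $\operatorname{tr}(C'\gamma'X_t\theta)$ of the entries of $\gamma'X_t\theta$. 2. Processes as in 1 describe the model for every initial value: if $(X_t)_{t\ge0}$ satisfies the MECM almost surely for each $t\ge1$ with an arbitrary square-integrable $X_0$, then there is a process $(Z_t)_{t\in\mathbb Z}$ as in 1, driven by the same $E$, such that each entry of $X_t-Z_t$ tends to $0$ in mean square as $t\to\infty$. -/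

import Mathlib

open Matrix MeasureTheory ProbabilityTheory Filter Topology
open scoped Kronecker NNReal

/-- The coefficient matrix `φθ' ⊗ τγ'` of the vectorized model; the index `(j, i)` is the place of
the entry `X i j` in `vec X` (columns stacked). -/
def mecmPi {m n r₁ r₂ : ℕ} (τ γ : Matrix (Fin m) (Fin r₁) ℝ) (θ φ : Matrix (Fin n) (Fin r₂) ℝ) :
    Matrix (Fin n × Fin m) (Fin n × Fin m) ℝ :=
  (φ * θᵀ) ⊗ₖ (τ * γᵀ)

/-- The characteristic matrix `A(z) = (1 - z) I - z (φθ' ⊗ τγ')`, for complex `z`. -/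
noncomputable def mecmChar {m n r₁ r₂ : ℕ} (τ γ : Matrix (Fin m) (Fin r₁) ℝ)
    (θ φ : Matrix (Fin n) (Fin r₂) ℝ) (z : ℂ) : Matrix (Fin n × Fin m) (Fin n × Fin m) ℂ :=
  (1 - z) • (1 : Matrix (Fin n × Fin m) (Fin n × Fin m) ℂ)
    - z • (mecmPi τ γ θ φ).map (fun x : ℝ => (x : ℂ))

/-- Every root of `det A(z)` lies outside the closed unit disc or equals one. -/
def RootCondition {m n r₁ r₂ : ℕ} (τ γ : Matrix (Fin m) (Fin r₁) ℝ)
    (θ φ : Matrix (Fin n) (Fin r₂) ℝ) : Prop :=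
  ∀ z : ℂ, (mecmChar τ γ θ φ z).det = 0 → 1 < ‖z‖ ∨ z = 1

/-- The unit eigenvalue of the autoregressive matrix `I + φθ' ⊗ τγ'` is semisimple. -/
def SemisimpleUnitRoot {m n r₁ r₂ : ℕ} (τ γ : Matrix (Fin m) (Fin r₁) ℝ)
    (θ φ : Matrix (Fin n) (Fin r₂) ℝ) : Prop :=
  Module.End.maxGenEigenspace (Matrix.toLin' (1 + mecmPi τ γ θ φ)) 1
    = Module.End.eigenspace (Matrix.toLin' (1 + mecmPi τ γ θ φ)) 1

/-- Matrix white noise on the time axis `ℤ`: square integrable, centred, uncorrelated over time,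
with the same covariance matrix `S` (of the entries) at every time. -/
structure IsWhiteNoise {Ω : Type*} [MeasurableSpace Ω] (μ : Measure Ω) {a b : ℕ}
    (E : ℤ → Ω → Matrix (Fin a) (Fin b) ℝ)
    (S : Matrix (Fin a × Fin b) (Fin a × Fin b) ℝ) : Prop where
  memLp : ∀ t i j, MemLp (fun ω => E t ω i j) 2 μ
  mean : ∀ t i j, ∫ ω, E t ω i j ∂μ = 0
  cov_same : ∀ t i j k l, ∫ ω, E t ω i j * E t ω k l ∂μ = S (i, j) (k, l)
  cov_ne : ∀ s t, s ≠ t → ∀ i j k l, ∫ ω, E s ω i j * E t ω k l ∂μ = 0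

/-- Weak (second-order) stationarity of a matrix-valued process. -/
structure IsWeaklyStationary {Ω : Type*} [MeasurableSpace Ω] (μ : Measure Ω) {p q : ℕ}
    (Y : ℤ → Ω → Matrix (Fin p) (Fin q) ℝ) : Prop where
  memLp : ∀ t i j, MemLp (fun ω => Y t ω i j) 2 μ
  mean : ∀ t h i j, ∫ ω, Y (t + h) ω i j ∂μ = ∫ ω, Y t ω i j ∂μ
  cov : ∀ s t h i j k l,
    cov[fun ω => Y (s + h) ω i j, fun ω => Y (t + h) ω k l; μ]
      = cov[fun ω => Y s ω i j, fun ω => Y t ω k l; μ]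

/-- `I(0)` for a matrix-valued process: `Y_t = M + ∑_{l ≥ 0} C_l(ε_{t-l})`, a mean-square convergent
causal linear process in a matrix white noise `ε` with nonsingular covariance, whose coefficients
decay exponentially (so that `C(z) = ∑ C_l z^l` converges in a disc of radius larger than one) and
satisfy `C(1) = ∑ C_l ≠ 0`. -/
def IsI0 {Ω : Type*} [MeasurableSpace Ω] (μ : Measure Ω) {p q : ℕ}
    (Y : ℤ → Ω → Matrix (Fin p) (Fin q) ℝ) : Prop :=
  (∀ t i j, MemLp (fun ω => Y t ω i j) 2 μ) ∧
  ∃ (a b : ℕ) (ε : ℤ → Ω → Matrix (Fin a) (Fin b) ℝ)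
    (S : Matrix (Fin a × Fin b) (Fin a × Fin b) ℝ)
    (M : Matrix (Fin p) (Fin q) ℝ)
    (C : ℕ → Matrix (Fin a) (Fin b) ℝ →ₗ[ℝ] Matrix (Fin p) (Fin q) ℝ),
    IsWhiteNoise μ ε S ∧ S.PosDef ∧
    (∃ K ρ : ℝ, 0 ≤ ρ ∧ ρ < 1 ∧
      ∀ l c d i j, |C l (Matrix.single c d 1) i j| ≤ K * ρ ^ l) ∧
    (∃ x i j, ∑' l, C l x i j ≠ 0) ∧
    (∀ t i j, Tendsto (fun N : ℕ => eLpNorm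
      (fun ω => (Y t ω - M - ∑ l ∈ Finset.range N, C l (ε (t - (l : ℤ)) ω)) i j) 2 μ)
      atTop (𝓝 0))

/-- `I(1)`: the first difference is `I(0)`. -/
def IsI1 {Ω : Type*} [MeasurableSpace Ω] (μ : Measure Ω) {p q : ℕ}
    (Y : ℤ → Ω → Matrix (Fin p) (Fin q) ℝ) : Prop :=
  IsI0 μ (fun t ω => Y t ω - Y (t - 1) ω)

/-- A square-integrable process on `ℤ` that satisfies `ΔX_t = τγ'X_{t-1}θφ' + E_t` at all times and
whose increments are bounded in mean square over the past. The bound only removes the solutions of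
the homogeneous equation that explode as `t → -∞`. -/
structure IsMECM {Ω : Type*} [MeasurableSpace Ω] (μ : Measure Ω) {m n r₁ r₂ : ℕ}
    (τ γ : Matrix (Fin m) (Fin r₁) ℝ) (θ φ : Matrix (Fin n) (Fin r₂) ℝ)
    (E X : ℤ → Ω → Matrix (Fin m) (Fin n) ℝ) : Prop where
  memLp : ∀ t i j, MemLp (fun ω => X t ω i j) 2 μ
  eqn : ∀ t, ∀ᵐ ω ∂μ, X t ω - X (t - 1) ω = τ * γᵀ * X (t - 1) ω * θ * φᵀ + E t ω
  past : ∃ K : ℝ≥0, ∀ t : ℤ, t ≤ 0 → ∀ i j,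
    eLpNorm (fun ω => (X t ω - X (t - 1) ω) i j) 2 μ ≤ K

/-- A process on `ℕ` that starts from a square-integrable but otherwise arbitrary `X_0` and
satisfies `ΔX_t = τγ'X_{t-1}θφ' + E_t` for `t ≥ 1`. -/
structure IsStartedMECM {Ω : Type*} [MeasurableSpace Ω] (μ : Measure Ω) {m n r₁ r₂ : ℕ}
    (τ γ : Matrix (Fin m) (Fin r₁) ℝ) (θ φ : Matrix (Fin n) (Fin r₂) ℝ)
    (E : ℤ → Ω → Matrix (Fin m) (Fin n) ℝ) (X : ℕ → Ω → Matrix (Fin m) (Fin n) ℝ) : Prop where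
  memLp_zero : ∀ i j, MemLp (fun ω => X 0 ω i j) 2 μ
  eqn : ∀ t : ℕ, ∀ᵐ ω ∂μ,
    X (t + 1) ω - X t ω = τ * γᵀ * X t ω * θ * φᵀ + E ((t : ℤ) + 1) ω

/-! ### Exponential decay of powers from the spectrum -/

section PowerBound

/-! Put `U c = τcφ'` and `W x = γ'xθ`, so that the model reads `Δx_t = U W x_{t-1} + e_t`.
Semisimplicity of the unit root makes `W U` injective, hence `γ'τ` and `φ'θ` are invertible and `W
U` has an inverse `T`. A nonzero eigenvalue of `1 + W U` is an eigenvalue of `1 + U W`, so its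
reciprocal is a characteristic root; the eigenvalue one is excluded by invertibility, and the powers
of `1 + W U` decay. This is `stableFactor_mecm`. The solutions are then studied for abstract `U`,
`W`, `T`, and the results are applied in `L²`, where these maps act pointwise.

Applying `W` to the model gives the autoregression `w_t = (1 + W U) w_{t-1} + W e_t`. Increments
bounded in the past bound `w` in the past, so `w` is the causal solution: `W x` is a moving average
with exponentially decaying coefficients. So is `Δx_t = e_t + U w_{t-1}`, with coefficient sum `J =
1 - U T W`, the projection onto `ker W` along the range of `U`. As `r₁ < m` and `r₂ < n`, `ker W`
contains matrices that `γ'x` and `xθ` still see; this makes the one-sided processes `I(1)`.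

Conversely, let `f x` be bounded in mean square. Then `g = f J` kills the range of `U`, so `g x` is
a bounded random walk with increments `g e`; positive definiteness forces `g = 0`, and `f` vanishes
on `ker W` (`StableFactor.eq_zero_of_bounded`). `I(0)` and stationary processes are bounded, so the
one-sided processes are not `I(0)`, and stationarity of `tr(B'x)` forces `B = γCθ'`.

For a started process, `U T w + J z` with `z` a two-sided random walk solves the model, and two
solutions that agree in `J x_0` merge geometrically (`exists_solution`, `tendsto_sub`). -/

theorem exists_norm_pow_le_of_spectralRadius_lt_one {A : Type*} [NormedRing A] [NormedAlgebra ℂ A]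
    [CompleteSpace A] [Nontrivial A] (a : A) (ha : ∀ z ∈ spectrum ℂ a, ‖z‖ < 1) :
    ∃ K ρ : ℝ, 0 ≤ ρ ∧ ρ < 1 ∧ ∀ k, ‖a ^ k‖ ≤ K * ρ ^ k := by
  have h1 : spectralRadius ℂ a < ((1 : ℝ≥0) : ENNReal) :=
    spectrum.spectralRadius_lt_of_forall_lt a fun z hz => by
      have := ha z hz
      exact_mod_cast this
  obtain ⟨r, hr, hr1⟩ := ENNReal.lt_iff_exists_nnreal_btwn.1 h1
  have hr1 : r < 1 := by exact_mod_cast hr1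
  have hr0 : 0 < r := by
    have := lt_of_le_of_lt zero_le hr
    exact_mod_cast this
  -- Gelfand's formula: `‖a ^ k‖ ^ (1 / k)` converges to the spectral radius, so it is eventually
  -- below `r`.
  have hev := (spectrum.pow_nnnorm_pow_one_div_tendsto_nhds_spectralRadius a).eventually_lt_const hr
  have hO : (fun k => a ^ k) =O[atTop] fun k => (r : ℝ) ^ k := by
    refine Asymptotics.IsBigO.of_bound 1 ?_
    filter_upwards [hev, eventually_gt_atTop 0] with k hk hk0
    have h2 : (‖a ^ k‖₊ : ENNReal) ≤ (r : ENNReal) ^ k := by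
      have h3 := ENNReal.rpow_le_rpow hk.le (z := (k : ℝ)) (by positivity)
      rwa [← ENNReal.rpow_mul, one_div, inv_mul_cancel₀ (by positivity), ENNReal.rpow_one,
        ENNReal.rpow_natCast] at h3
    have h4 : ‖a ^ k‖₊ ≤ r ^ k := by exact_mod_cast h2
    have h5 : ‖a ^ k‖ ≤ (r : ℝ) ^ k := by exact_mod_cast h4
    simpa using h5
  -- `r > 0` matters here: `r ^ k` never vanishes, so the early exponents are absorbed in the
  -- constant.
  obtain ⟨C, -, hC⟩ := Asymptotics.bound_of_isBigO_nat_atTop hO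
  refine ⟨C, r, r.2, by exact_mod_cast hr1, fun k => ?_⟩
  have := hC (x := k) (by positivity)
  simpa using this

end PowerBound

/-! ### Causal solutions of a stable linear recursion -/

section LinearRecursion

variable {B : Type*} [NormedAddCommGroup B] [NormedSpace ℝ B]

/-- Powers of `G` decay exponentially. -/
def PowerStable (G : B →L[ℝ] B) : Prop :=
  ∃ K ρ : ℝ, 0 ≤ ρ ∧ ρ < 1 ∧ ∀ k, ‖G ^ k‖ ≤ K * ρ ^ k

namespace PowerStable

variable {G : B →L[ℝ] B}

theorem tendsto_pow_apply (hG : PowerStable G) (x : B) :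
    Tendsto (fun k => (G ^ k) x) atTop (𝓝 0) := by
  obtain ⟨K, ρ, h0, h1, hK⟩ := hG
  refine squeeze_zero_norm (a := fun k => K * ρ ^ k * ‖x‖)
    (fun k => ((G ^ k).le_opNorm x).trans (by gcongr; exact hK k)) ?_
  simpa using ((tendsto_pow_atTop_nhds_zero_of_lt_one h0 h1).const_mul K).mul_const ‖x‖

theorem summable [CompleteSpace B] (hG : PowerStable G) {e : ℕ → B} {c : ℝ}
    (he : ∀ l, ‖e l‖ ≤ c) : Summable fun l => (G ^ l) (e l) := by
  obtain ⟨K, ρ, h0, h1, hK⟩ := hG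
  refine Summable.of_norm_bounded
    (((summable_geometric_of_lt_one h0 h1).mul_left K).mul_right c) fun l => ?_
  have := hK l
  have h2 : 0 ≤ K * ρ ^ l := (norm_nonneg _).trans this
  exact ((G ^ l).le_opNorm _).trans (mul_le_mul this (he l) (norm_nonneg _) h2)

/-- The bound is fixed before the sequence, so it serves the causal solution at all times at once.
-/
theorem exists_norm_tsum_le [CompleteSpace B] (hG : PowerStable G) (c : ℝ) :
    ∃ R, ∀ e : ℕ → B, (∀ l, ‖e l‖ ≤ c) → ‖∑' l, (G ^ l) (e l)‖ ≤ R := by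
  obtain ⟨K, ρ, h0, h1, hK⟩ := hG
  refine ⟨∑' l, K * ρ ^ l * c, fun e he => ?_⟩
  refine tsum_of_norm_bounded
    (((summable_geometric_of_lt_one h0 h1).mul_left K).mul_right c).hasSum fun l => ?_
  have := hK l
  have h2 : 0 ≤ K * ρ ^ l := (norm_nonneg _).trans this
  exact ((G ^ l).le_opNorm _).trans (mul_le_mul this (he l) (norm_nonneg _) h2)

/-- The causal solution of `w t = G (w (t - 1)) + e t`. -/
noncomputable def causal (G : B →L[ℝ] B) (e : ℤ → B) (t : ℤ) : B :=
  ∑' l : ℕ, (G ^ l) (e (t - l))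

theorem eq_pow_apply {d : ℤ → B} (hd : ∀ t, d t = G (d (t - 1))) (t : ℤ) (k : ℕ) :
    d t = (G ^ k) (d (t - k)) := by
  induction k with
  | zero => simp
  | succ k ih =>
    rw [ih, hd (t - k), pow_succ]
    push_cast
    rw [show t - (k : ℤ) - 1 = t - (k + 1) by ring]
    rfl

variable [CompleteSpace B] {e : ℤ → B} {c : ℝ}

theorem hasSum_causal (hG : PowerStable G) (he : ∀ t, ‖e t‖ ≤ c) (t : ℤ) :
    HasSum (fun l : ℕ => (G ^ l) (e (t - l))) (causal G e t) :=
  (hG.summable fun _ => he _).hasSum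

theorem exists_norm_causal_le (hG : PowerStable G) (he : ∀ t, ‖e t‖ ≤ c) :
    ∃ R, ∀ t, ‖causal G e t‖ ≤ R := by
  obtain ⟨R, hR⟩ := hG.exists_norm_tsum_le c
  exact ⟨R, fun t => hR _ fun _ => he _⟩

theorem causal_eq (hG : PowerStable G) (he : ∀ t, ‖e t‖ ≤ c) (t : ℤ) :
    causal G e t = G (causal G e (t - 1)) + e t := by
  have h := (hG.summable (e := fun l : ℕ => e (t - l)) fun _ => he _).tsum_eq_zero_add
  have h2 : ∑' l : ℕ, (G ^ (l + 1)) (e (t - ((l + 1 : ℕ) : ℤ))) = G (causal G e (t - 1)) := by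
    rw [causal, G.map_tsum (hG.summable fun _ => he _)]
    refine tsum_congr fun l => ?_
    rw [pow_succ']
    push_cast
    rw [show t - ((l : ℤ) + 1) = t - 1 - l by ring]
    rfl
  rw [h2] at h
  rw [causal, h]
  simp [add_comm]

/-- A solution that is bounded in the past is the causal one. -/
theorem eq_causal_of_bounded_past (hG : PowerStable G) (he : ∀ t, ‖e t‖ ≤ c) {w : ℤ → B}
    (hw : ∀ t, w t = G (w (t - 1)) + e t) {R : ℝ} (hR : ∀ t ≤ (-1 : ℤ), ‖w t‖ ≤ R) (t : ℤ) :
    w t = causal G e t := by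
  obtain ⟨R', hR'⟩ := hG.exists_norm_causal_le he
  have hd : ∀ t, (w t - causal G e t) = G (w (t - 1) - causal G e (t - 1)) := fun t => by
    rw [hw t, hG.causal_eq he t, map_sub]; abel
  have hpow := eq_pow_apply (d := fun t => w t - causal G e t) hd t
  obtain ⟨K, ρ, h0, h1, hK⟩ := hG
  have hlim : Tendsto (fun k : ℕ => K * ρ ^ k * (R + R')) atTop (𝓝 0) := by
    simpa using ((tendsto_pow_atTop_nhds_zero_of_lt_one h0 h1).const_mul K).mul_const (R + R')
  rw [← sub_eq_zero, ← norm_le_zero_iff]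
  refine ge_of_tendsto hlim ?_
  -- So many steps back, the time `t - k` is at most `-1`, where both solutions are bounded; their
  -- difference at `t` is `G ^ k` of a bounded vector.
  filter_upwards [eventually_ge_atTop (t + 1).toNat] with k hk
  have := hK k
  have h2 : 0 ≤ K * ρ ^ k := (norm_nonneg _).trans this
  have h3 : ‖w (t - k) - causal G e (t - k)‖ ≤ R + R' :=
    (norm_sub_le _ _).trans (add_le_add (hR _ (by omega)) (hR' _))
  calc ‖w t - causal G e t‖ = ‖(G ^ k) (w (t - k) - causal G e (t - k))‖ := by
        rw [← hpow k]
    _ ≤ _ := ((G ^ k).le_opNorm _).trans (mul_le_mul this h3 (norm_nonneg _) h2)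

end PowerStable

end LinearRecursion

/-! ### Linear maps acting on square-integrable random vectors -/

section LpLift

variable {Ω : Type*} [MeasurableSpace Ω] {μ : Measure Ω}
  {U V W : Type*} [NormedAddCommGroup U] [NormedSpace ℝ U] [NormedAddCommGroup V] [NormedSpace ℝ V]
  [NormedAddCommGroup W] [NormedSpace ℝ W]

/-- The action of a continuous linear map on square-integrable random vectors. -/
noncomputable abbrev lift (μ : Measure Ω) (L : U →L[ℝ] V) : Lp U 2 μ →L[ℝ] Lp V 2 μ :=
  L.compLpL 2 μ

theorem lift_comp (L : V →L[ℝ] W) (M : U →L[ℝ] V) (x : Lp U 2 μ) :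
    lift μ (L ∘L M) x = lift μ L (lift μ M x) := by
  apply Lp.ext
  filter_upwards [(L ∘L M).coeFn_compLpL (p := 2) x, L.coeFn_compLpL (p := 2) (lift μ M x),
    M.coeFn_compLpL (p := 2) x] with ω h1 h2 h3
  rw [h1, h2, h3]; rfl

theorem lift_id (x : Lp U 2 μ) : lift μ (ContinuousLinearMap.id ℝ U) x = x := by
  apply Lp.ext
  filter_upwards [(ContinuousLinearMap.id ℝ U).coeFn_compLpL (p := 2) x] with ω h1
  rw [h1]; rfl

theorem lift_add (L M : U →L[ℝ] V) (x : Lp U 2 μ) :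
    lift μ (L + M) x = lift μ L x + lift μ M x := by
  simp [lift, ContinuousLinearMap.add_compLpL]

theorem lift_smul (c : ℝ) (L : U →L[ℝ] V) (x : Lp U 2 μ) :
    lift μ (c • L) x = c • lift μ L x := by
  simp [lift, ContinuousLinearMap.smul_compLpL]

theorem lift_zero (x : Lp U 2 μ) : lift μ (0 : U →L[ℝ] V) x = 0 := by
  simpa using lift_smul (0 : ℝ) (0 : U →L[ℝ] V) x

theorem lift_sub (L M : U →L[ℝ] V) (x : Lp U 2 μ) :
    lift μ (L - M) x = lift μ L x - lift μ M x := by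
  rw [eq_sub_iff_add_eq, ← lift_add, sub_add_cancel]

theorem lift_sum {ι : Type*} (s : Finset ι) (L : ι → U →L[ℝ] V) (x : Lp U 2 μ) :
    lift μ (∑ i ∈ s, L i) x = ∑ i ∈ s, lift μ (L i) x := by
  classical
  induction s using Finset.induction_on with
  | empty => simpa using lift_zero x
  | insert a s ha ih => rw [Finset.sum_insert ha, Finset.sum_insert ha, lift_add, ih]

theorem lift_pow (L : U →L[ℝ] U) (k : ℕ) (x : Lp U 2 μ) :
    lift μ (L ^ k) x = (lift μ L ^ k) x := by
  induction k generalizing x with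
  | zero => exact lift_id x
  | succ k ih =>
    rw [pow_succ, pow_succ]
    exact (lift_comp _ _ _).trans (ih _)

/-- Lifting commutes with powers and does not increase operator norms, so the same constants work.
-/
theorem PowerStable.lift {L : U →L[ℝ] U} (hL : PowerStable L) : PowerStable (lift μ L) := by
  obtain ⟨K, ρ, h0, h1, hK⟩ := hL
  refine ⟨K, ρ, h0, h1, fun k => ?_⟩
  have : _root_.lift μ L ^ k = _root_.lift μ (L ^ k) := by ext1 x; exact (lift_pow L k x).symm
  rw [this]
  exact (ContinuousLinearMap.norm_compLpL_le (p := 2) (μ := μ) (L ^ k)).trans (hK k)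

theorem lift_toLp (L : U →L[ℝ] V) {X : Ω → U} (hX : MemLp X 2 μ) :
    lift μ L (hX.toLp X) = (L.comp_memLp' hX).toLp (fun ω => L (X ω)) := by
  apply Lp.ext
  filter_upwards [L.coeFn_compLpL (p := 2) (hX.toLp X), hX.coeFn_toLp,
    (L.comp_memLp' hX).coeFn_toLp] with ω h1 h2 h3
  rw [h1, h2]; exact h3.symm

end LpLift

/-! ### White noise in `L²` -/

section WhiteNoise

variable {Ω : Type*} [MeasurableSpace Ω] {μ : Measure Ω}
  {V F : Type*} [NormedAddCommGroup V] [NormedSpace ℝ V] [NormedAddCommGroup F] [NormedSpace ℝ F]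

/-- White noise with nondegenerate covariance, as a sequence in `L²`. -/
structure IsLpWhite (e : ℤ → Lp V 2 μ) : Prop where
  bdd : ∃ c, ∀ t, ‖e t‖ ≤ c
  mean : ∀ t (f : V →L[ℝ] ℝ), ∫ ω, lift μ f (e t) ω ∂μ = 0
  same : ∀ s t (f g : V →L[ℝ] ℝ),
    inner ℝ (lift μ f (e s)) (lift μ g (e s)) = inner ℝ (lift μ f (e t)) (lift μ g (e t))
  orth : ∀ s t, s ≠ t → ∀ f g : V →L[ℝ] ℝ, inner ℝ (lift μ f (e s)) (lift μ g (e t)) = 0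
  nondeg : ∀ f : V →L[ℝ] ℝ, lift μ f (e 0) = 0 → f = 0

namespace IsLpWhite

variable {e : ℤ → Lp V 2 μ}

theorem inner_shift (he : IsLpWhite e) (s t h : ℤ) (f g : V →L[ℝ] ℝ) :
    inner ℝ (lift μ f (e (s + h))) (lift μ g (e (t + h)))
      = inner ℝ (lift μ f (e s)) (lift μ g (e t)) := by
  rcases eq_or_ne s t with rfl | hst
  · exact he.same _ _ _ _
  · rw [he.orth _ _ hst, he.orth _ _ (by simpa using hst)]

theorem hasSum_lift {w : Lp F 2 μ} {C : ℕ → V →L[ℝ] F} {t : ℤ}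
    (hw : HasSum (fun l : ℕ => lift μ (C l) (e (t - l))) w) (f : F →L[ℝ] ℝ) :
    Tendsto (fun N : ℕ => ∑ l ∈ Finset.range N, lift μ (f ∘L C l) (e (t - l))) atTop
      (𝓝 (lift μ f w)) := by
  have := (hw.mapL (lift μ f)).tendsto_sum_nat
  simpa only [lift_comp] using this

/-- By continuity of the inner product it suffices to compare partial sums, and these agree term by
term under a time shift. -/
theorem inner_linear_shift (he : IsLpWhite e) {w : ℤ → Lp F 2 μ} {C : ℕ → V →L[ℝ] F}
    (hw : ∀ t, HasSum (fun l : ℕ => lift μ (C l) (e (t - l))) (w t)) (s t h : ℤ)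
    (f g : F →L[ℝ] ℝ) :
    inner ℝ (lift μ f (w (s + h))) (lift μ g (w (t + h)))
      = inner ℝ (lift μ f (w s)) (lift μ g (w t)) := by
  have h1 := (hasSum_lift (hw (s + h)) f).inner (𝕜 := ℝ) (hasSum_lift (hw (t + h)) g)
  have h2 := (hasSum_lift (hw s) f).inner (𝕜 := ℝ) (hasSum_lift (hw t) g)
  refine tendsto_nhds_unique h1 (h2.congr fun N => ?_)
  simp only [sum_inner, inner_sum]
  refine Finset.sum_congr rfl fun k _ => Finset.sum_congr rfl fun l _ => ?_
  rw [show s + h - (l : ℤ) = s - l + h by ring, show t + h - (k : ℤ) = t - k + h by ring,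
    he.inner_shift]

/-- On a finite measure space the expectation is the inner product with the constant `1`, so it
passes to the limit of the partial sums. -/
theorem mean_linear [IsFiniteMeasure μ] (he : IsLpWhite e) {w : Lp F 2 μ} {C : ℕ → V →L[ℝ] F}
    {t : ℤ} (hw : HasSum (fun l : ℕ => lift μ (C l) (e (t - l))) w) (f : F →L[ℝ] ℝ) :
    ∫ ω, lift μ f w ω ∂μ = 0 := by
  have key : ∀ x : Lp ℝ 2 μ, inner ℝ
      (indicatorConstLp 2 MeasurableSet.univ (measure_ne_top μ _) (1 : ℝ)) x = ∫ ω, x ω ∂μ :=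
    fun x => by
      rw [L2.inner_indicatorConstLp_one, setIntegral_univ]
  rw [← key]
  refine tendsto_nhds_unique (tendsto_const_nhds.inner (𝕜 := ℝ) (hasSum_lift hw f))
    (tendsto_const_nhds.congr fun N => ?_)
  rw [inner_sum]
  exact (Finset.sum_eq_zero fun l _ => by rw [key, he.mean]).symm

/-- The partial sums of nondegenerate white noise are unbounded. -/
theorem eq_zero_of_bounded_sum (he : IsLpWhite e) (g : V →L[ℝ] ℝ) {R : ℝ}
    (hR : ∀ N : ℕ, ‖∑ k ∈ Finset.range N, lift μ g (e (k + 1))‖ ≤ R) : g = 0 := by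
  -- Orthogonality in time: the variance of the sum grows linearly in `N` unless the single term
  -- vanishes.
  have hsq : ∀ N : ℕ, ‖∑ k ∈ Finset.range N, lift μ g (e (k + 1))‖ ^ 2
      = N * ‖lift μ g (e 0)‖ ^ 2 := by
    intro N
    rw [← real_inner_self_eq_norm_sq, sum_inner]
    have : ∀ k ∈ Finset.range N, inner ℝ (lift μ g (e (k + 1)))
        (∑ l ∈ Finset.range N, lift μ g (e (l + 1))) = ‖lift μ g (e 0)‖ ^ 2 := by
      intro k hk
      rw [inner_sum, Finset.sum_eq_single_of_mem k hk, he.same _ 0, real_inner_self_eq_norm_sq]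
      intro l _ hl
      exact he.orth _ _ (by simpa using hl.symm) _ _
    rw [Finset.sum_congr rfl this]
    simp
  apply he.nondeg
  by_contra hne
  have hpos : 0 < ‖lift μ g (e 0)‖ ^ 2 := by positivity
  obtain ⟨N, hN⟩ := exists_nat_gt (R ^ 2 / ‖lift μ g (e 0)‖ ^ 2)
  rw [div_lt_iff₀ hpos, ← hsq N] at hN
  exact absurd (pow_le_pow_left₀ (norm_nonneg _) (hR N) 2) (not_le.2 hN)

end IsLpWhite

end WhiteNoise

/-! ### Error correction models in normed spaces -/

section ErrorCorrection

variable {V F Y : Type*} [NormedAddCommGroup V] [NormedSpace ℝ V] [NormedAddCommGroup F]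
  [NormedSpace ℝ F] [NormedAddCommGroup Y] [NormedSpace ℝ Y]

/-- The feedback `U ∘ W` of an error correction model whose cointegrating combination `W x` is
stable: `W ∘ U` is invertible with inverse `T`, and the powers of `1 + W ∘ U` decay. -/
structure StableFactor (U : F →L[ℝ] V) (W : V →L[ℝ] F) (T : F →L[ℝ] F) : Prop where
  left : ∀ c, T (W (U c)) = c
  right : ∀ c, W (U (T c)) = c
  stable : PowerStable (1 + W ∘L U)

/-- The solutions of the error correction model `Δx_t = U W x_{t-1} + e_t`. -/
def SolvesECM (U : F →L[ℝ] V) (W : V →L[ℝ] F) (e x : ℤ → V) : Prop :=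
  ∀ t, x t - x (t - 1) = U (W (x (t - 1))) + e t

/-- The coefficients of the moving average representation of `L Δx_t`. -/
noncomputable def diffCoeff (U : F →L[ℝ] V) (W : V →L[ℝ] F) (L : V →L[ℝ] Y) : ℕ → V →L[ℝ] Y
  | 0 => L
  | l + 1 => L ∘L U ∘L ((1 + W ∘L U) ^ l) ∘L W

namespace StableFactor

variable {U : F →L[ℝ] V} {W : V →L[ℝ] F} {T : F →L[ℝ] F} {e x : ℤ → V}

theorem map_solution (hx : SolvesECM U W e x) (t : ℤ) :
    W (x t) = (1 + W ∘L U) (W (x (t - 1))) + W (e t) := by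
  have := congrArg W (hx t)
  rw [map_sub, map_add, sub_eq_iff_eq_add] at this
  rw [this]
  change _ = W (x (t - 1)) + W (U (W (x (t - 1)))) + _
  abel

/-- Since `T W U = 1`, the increment reveals the level: `W x_t = T W (Δx_{t+1} - e_{t+1})`.
Increments bounded up to time `0` thus bound `W x` up to time `-1`, and uniqueness of the
past-bounded solution applies. -/
theorem map_eq_causal [CompleteSpace F] (h : StableFactor U W T) {c R : ℝ} (he : ∀ t, ‖e t‖ ≤ c)
    (hx : SolvesECM U W e x) (hR : ∀ t ≤ 0, ‖x t - x (t - 1)‖ ≤ R) (t : ℤ) :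
    W (x t) = PowerStable.causal (1 + W ∘L U) (fun t => W (e t)) t := by
  refine h.stable.eq_causal_of_bounded_past (c := ‖W‖ * c) (R := ‖T ∘L W‖ * (R + c))
    (fun t => (W.le_opNorm _).trans (by gcongr; exact he t)) (map_solution hx) (fun t ht => ?_) t
  have h1 := hx (t + 1)
  rw [add_sub_cancel_right] at h1
  have h2 : W (x t) = (T ∘L W) ((x (t + 1) - x t) - e (t + 1)) := by
    rw [h1, add_sub_cancel_right]; exact (h.left _).symm
  rw [h2]
  refine (ContinuousLinearMap.le_opNorm _ _).trans ?_
  gcongr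
  have h3 := hR (t + 1) (by omega)
  rw [add_sub_cancel_right] at h3
  exact (norm_sub_le _ _).trans (add_le_add h3 (he _))

theorem hasSum_map [CompleteSpace F] (h : StableFactor U W T) {c R : ℝ} (he : ∀ t, ‖e t‖ ≤ c)
    (hx : SolvesECM U W e x) (hR : ∀ t ≤ 0, ‖x t - x (t - 1)‖ ≤ R) (t : ℤ) :
    HasSum (fun l : ℕ => (((1 + W ∘L U) ^ l) ∘L W) (e (t - l))) (W (x t)) := by
  rw [h.map_eq_causal he hx hR]
  exact h.stable.hasSum_causal (e := fun t => W (e t)) (c := ‖W‖ * c)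
    (fun t => (W.le_opNorm _).trans (by gcongr; exact he t)) t

theorem exists_norm_map_le [CompleteSpace F] (h : StableFactor U W T) {c R : ℝ}
    (he : ∀ t, ‖e t‖ ≤ c) (hx : SolvesECM U W e x) (hR : ∀ t ≤ 0, ‖x t - x (t - 1)‖ ≤ R) :
    ∃ K, ∀ t, ‖W (x t)‖ ≤ K := by
  obtain ⟨K, hK⟩ := h.stable.exists_norm_causal_le (e := fun t => W (e t)) (c := ‖W‖ * c)
    (fun t => (W.le_opNorm _).trans (by gcongr; exact he t))
  exact ⟨K, fun t => by rw [h.map_eq_causal he hx hR]; exact hK t⟩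

/-- In `Δx_t = e_t + U W x_{t-1}` the noise term is the coefficient at lag zero, and the series of
`W x_{t-1}` fills the lags from one on. -/
theorem hasSum_diff [CompleteSpace F] (h : StableFactor U W T) {c R : ℝ} (he : ∀ t, ‖e t‖ ≤ c)
    (hx : SolvesECM U W e x) (hR : ∀ t ≤ 0, ‖x t - x (t - 1)‖ ≤ R) (L : V →L[ℝ] Y) (t : ℤ) :
    HasSum (fun l : ℕ => diffCoeff U W L l (e (t - l))) (L (x t - x (t - 1))) := by
  have h1 := (h.hasSum_map he hx hR (t - 1)).mapL (L ∘L U)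
  rw [hx t, map_add, add_comm]
  have h2 := (hasSum_nat_add_iff' (f := fun l : ℕ => diffCoeff U W L l (e (t - l)))
    (g := L (e t) + L (U (W (x (t - 1))))) 1).1
  apply h2
  simp only [Finset.range_one, Finset.sum_singleton, diffCoeff, Nat.cast_zero, sub_zero,
    add_sub_cancel_left]
  convert h1 using 2 with l
  push_cast
  · rw [show t - ((l : ℤ) + 1) = t - 1 - l by ring]
    rfl
  · rfl

/-- Neumann series for `(1 - (1 + W U))⁻¹ = -(W U)⁻¹`; the partial sums telescope because `(1 + W U)
T y = T y + y`. -/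
theorem hasSum_pow (h : StableFactor U W T) (y : F) :
    HasSum (fun l : ℕ => ((1 + W ∘L U) ^ l) y) (-(T y)) := by
  obtain ⟨K, ρ, h0, h1, hK⟩ := h.stable
  have hsum : Summable fun l : ℕ => ‖((1 + W ∘L U) ^ l) y‖ := by
    refine Summable.of_nonneg_of_le (fun _ => norm_nonneg _) (fun l => ?_)
      (((summable_geometric_of_lt_one h0 h1).mul_left K).mul_right ‖y‖)
    exact (ContinuousLinearMap.le_opNorm _ _).trans (by gcongr; exact hK l)
  have hpart : ∀ N : ℕ, ∑ l ∈ Finset.range N, ((1 + W ∘L U) ^ l) y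
      = ((1 + W ∘L U) ^ N) (T y) - T y := by
    intro N
    induction N with
    | zero => simp
    | succ N ih =>
      rw [Finset.sum_range_succ, ih, pow_succ]
      have : (1 + W ∘L U) (T y) = T y + y := by
        simp [h.right]
      change _ = ((1 + W ∘L U) ^ N) ((1 + W ∘L U) (T y)) - T y
      rw [this, map_add]; abel
  rw [hasSum_iff_tendsto_nat_of_summable_norm hsum]
  simp_rw [hpart]
  simpa using (h.stable.tendsto_pow_apply (T y)).sub_const (T y)

/-- The long-run effect of a shock is `1 - U T W`, the projection onto `ker W` along the range of
`U`; on `ker W` the sum is just `L`. -/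
theorem hasSum_diffCoeff (h : StableFactor U W T) (L : V →L[ℝ] Y) (v : V) :
    HasSum (fun l : ℕ => diffCoeff U W L l v) (L v - L (U (T (W v)))) := by
  have h1 := (h.hasSum_pow (W v)).mapL (L ∘L U)
  refine (hasSum_nat_add_iff' 1).1 ?_
  simpa [diffCoeff] using h1

theorem exists_norm_coeff_le (h : StableFactor U W T) :
    ∃ K ρ : ℝ, 0 ≤ ρ ∧ ρ < 1 ∧ ∀ l, ‖((1 + W ∘L U) ^ l) ∘L W‖ ≤ K * ρ ^ l := by
  obtain ⟨K, ρ, h0, h1, hK⟩ := h.stable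
  refine ⟨K * ‖W‖, ρ, h0, h1, fun l => (ContinuousLinearMap.opNorm_comp_le _ _).trans ?_⟩
  rw [mul_right_comm]
  gcongr
  exact hK l

theorem exists_norm_diffCoeff_le (h : StableFactor U W T) (L : V →L[ℝ] Y) :
    ∃ K ρ : ℝ, 0 ≤ ρ ∧ ρ < 1 ∧ ∀ l, ‖diffCoeff U W L l‖ ≤ K * ρ ^ l := by
  obtain ⟨K, ρ, h0, h1, hK⟩ := h.exists_norm_coeff_le
  have hK0 : 0 ≤ K := by simpa using (norm_nonneg _).trans (hK 0)
  -- The lag shifted by one costs a factor `1 / r`, while `ρ` itself may be zero.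
  set r := max ρ (1 / 2)
  have hr : 0 < r := lt_max_of_lt_right (by norm_num)
  refine ⟨‖L‖ + ‖L ∘L U‖ * K / r, r, hr.le, max_lt h1 (by norm_num), fun l => ?_⟩
  cases l with
  | zero =>
    have : 0 ≤ ‖L ∘L U‖ * K / r := by positivity
    simpa [diffCoeff] using this
  | succ l =>
    have h2 : ‖diffCoeff U W L (l + 1)‖ ≤ ‖L ∘L U‖ * (K * r ^ l) := by
      refine (ContinuousLinearMap.opNorm_comp_le (L ∘L U) (((1 + W ∘L U) ^ l) ∘L W)).trans ?_
      gcongr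
      refine (hK l).trans ?_
      gcongr
      exact le_max_left _ _
    have h3 : (‖L‖ + ‖L ∘L U‖ * K / r) * r ^ (l + 1)
        = ‖L‖ * r ^ (l + 1) + ‖L ∘L U‖ * (K * r ^ l) := by
      rw [pow_succ]; field_simp
    rw [h3]
    have : 0 ≤ ‖L‖ * r ^ (l + 1) := by positivity
    linarith

theorem exists_walk {V : Type*} [AddCommGroup V] (e : ℤ → V) (x₀ : V) :
    ∃ z : ℤ → V, z 0 = x₀ ∧ ∀ t, z t - z (t - 1) = e t := by
  -- The forward sum starts with `e 1`, the backward one with `e 0`, because `e 0` is the step from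
  -- time `-1` to time `0`.
  refine ⟨fun t => x₀ + ∑ k ∈ Finset.range t.toNat, e (k + 1)
    - ∑ k ∈ Finset.range (-t).toNat, e (-k), by simp, fun t => ?_⟩
  rcases le_or_gt t 0 with ht | ht
  · obtain ⟨n, rfl⟩ : ∃ n : ℕ, t = -n := ⟨(-t).toNat, by omega⟩
    have h1 : (-(n : ℤ)).toNat = 0 := by omega
    have h2 : (-(n : ℤ) - 1).toNat = 0 := by omega
    have h3 : (-(-(n : ℤ))).toNat = n := by omega
    have h4 : (-(-(n : ℤ) - 1)).toNat = n + 1 := by omega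
    simp only [h1, h2, h3, h4, Finset.sum_range_succ]
    abel
  · obtain ⟨n, rfl⟩ : ∃ n : ℕ, t = n + 1 := ⟨(t - 1).toNat, by omega⟩
    have h1 : ((n : ℤ) + 1).toNat = n + 1 := by omega
    have h2 : ((n : ℤ) + 1 - 1).toNat = n := by omega
    have h3 : (-((n : ℤ) + 1)).toNat = 0 := by omega
    have h4 : (-((n : ℤ) + 1 - 1)).toNat = 0 := by omega
    simp only [h1, h2, h3, h4, Finset.sum_range_succ]
    abel

/-- Superpose the transitory part `U T w`, with `w` the causal solution of the autoregression for `W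
x`, and the projection to `ker W` of a random walk from `x₀`. Then `W x = w`, and the permanent
component at time `0` is that of `x₀`. -/
theorem exists_solution [CompleteSpace F] (h : StableFactor U W T) {c : ℝ} (he : ∀ t, ‖e t‖ ≤ c)
    (x₀ : V) :
    ∃ x : ℤ → V, SolvesECM U W e x ∧ (∃ R, ∀ t, ‖x t - x (t - 1)‖ ≤ R) ∧
      x 0 - U (T (W (x 0))) = x₀ - U (T (W x₀)) := by
  obtain ⟨z, hz0, hz⟩ := exists_walk e x₀
  have heW : ∀ t, ‖W (e t)‖ ≤ ‖W‖ * c := fun t => (W.le_opNorm _).trans (by gcongr; exact he t)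
  set w := PowerStable.causal (1 + W ∘L U) (fun t => W (e t))
  have hw : ∀ t, w t = w (t - 1) + W (U (w (t - 1))) + W (e t) := fun t => by
    have := h.stable.causal_eq heW t
    simpa using this
  have hWx : ∀ t, W (U (T (w t)) + (z t - U (T (W (z t))))) = w t := fun t => by
    simp [h.right]
  have hsol : SolvesECM U W e fun t => U (T (w t)) + (z t - U (T (W (z t)))) := by
    intro t
    have hz' : z t = z (t - 1) + e t := by rw [← hz t]; abel
    simp only [hWx]
    rw [hw t, hz']
    simp only [map_add, h.left]
    abel
  refine ⟨_, hsol, ?_, ?_⟩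
  · obtain ⟨R, hR⟩ := h.stable.exists_norm_causal_le heW
    refine ⟨‖U‖ * R + c, fun t => ?_⟩
    rw [hsol t, hWx]
    exact (norm_add_le _ _).trans
      (add_le_add ((U.le_opNorm _).trans (by gcongr; exact hR _)) (he t))
  · rw [hWx, hz0]
    abel

/-- Two solutions on `ℕ` with the same permanent component merge. -/
theorem tendsto_sub (h : StableFactor U W T) (hx : SolvesECM U W e x) {y : ℕ → V}
    (hy : ∀ t : ℕ, y (t + 1) - y t = U (W (y t)) + e (t + 1))
    (h0 : x 0 - U (T (W (x 0))) = y 0 - U (T (W (y 0)))) :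
    Tendsto (fun t : ℕ => y t - x t) atTop (𝓝 0) := by
  -- Equal permanent components put `y 0 - x 0` in the range of `U T W`. There `1 + U W` acts
  -- through `(1 + U W) U T = U T (1 + W U)`, so stable powers appear.
  have key : ∀ t : ℕ, y t - x t = U (T (((1 + W ∘L U) ^ t) (W (y 0 - x 0)))) := by
    intro t
    induction t with
    | zero =>
      simp only [pow_zero, one_apply_eq_self, Nat.cast_zero, map_sub]
      rw [sub_eq_sub_iff_add_eq_add] at h0 ⊢
      rw [add_comm (y 0), add_comm _ (x 0)]
      rw [h0, add_comm]
    | succ t ih =>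
      have h1 := hx (t + 1)
      rw [add_sub_cancel_right] at h1
      have h2 : y (t + 1) - x ((t : ℤ) + 1) = (y t - x t) + U (W (y t - x t)) := by
        rw [sub_eq_iff_eq_add.1 (hy t), sub_eq_iff_eq_add.1 h1]
        simp only [map_sub]; abel
      rw [Nat.cast_succ]
      rw [h2, ih, h.right, pow_succ']
      change _ = U (T ((1 + W ∘L U) (((1 + W ∘L U) ^ t) _)))
      have h3 : ∀ c, (1 + W ∘L U) c = c + W (U c) := fun c => rfl
      rw [h3, map_add, map_add, h.left]
  simp_rw [key]
  have hlim := ((U ∘L T).continuous.tendsto 0).comp (h.stable.tendsto_pow_apply (W (y 0 - x 0)))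
  rwa [map_zero] at hlim

end StableFactor

end ErrorCorrection

/-! ### Error correction models in `L²` -/

section LpErrorCorrection

variable {Ω : Type*} [MeasurableSpace Ω] {μ : Measure Ω}
  {V F Y : Type*} [NormedAddCommGroup V] [NormedSpace ℝ V] [NormedAddCommGroup F]
  [NormedSpace ℝ F] [NormedAddCommGroup Y] [NormedSpace ℝ Y]
  {U : F →L[ℝ] V} {W : V →L[ℝ] F} {T : F →L[ℝ] F}

theorem lift_one_add_comp (U : F →L[ℝ] V) (W : V →L[ℝ] F) :
    1 + lift μ W ∘L lift μ U = lift μ (1 + W ∘L U) := by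
  ext1 x
  rw [lift_add, lift_comp]
  change x + _ = lift μ (ContinuousLinearMap.id ℝ F) x + _
  rw [lift_id]; rfl

theorem StableFactor.lift (h : StableFactor U W T) :
    StableFactor (lift μ U) (lift μ W) (lift μ T) where
  left c := by
    rw [← lift_comp, ← lift_comp, show (T ∘L W) ∘L U = ContinuousLinearMap.id ℝ F from
      ContinuousLinearMap.ext h.left, lift_id]
  right c := by
    rw [← lift_comp, ← lift_comp, show (W ∘L U) ∘L T = ContinuousLinearMap.id ℝ F from
      ContinuousLinearMap.ext h.right, lift_id]
  stable := by
    rw [lift_one_add_comp]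
    exact h.stable.lift

theorem lift_coeff (U : F →L[ℝ] V) (W : V →L[ℝ] F) (l : ℕ) (x : Lp V 2 μ) :
    (((1 + lift μ W ∘L lift μ U) ^ l) ∘L lift μ W) x = lift μ (((1 + W ∘L U) ^ l) ∘L W) x := by
  rw [lift_comp, lift_pow, lift_one_add_comp]; rfl

theorem lift_diffCoeff (U : F →L[ℝ] V) (W : V →L[ℝ] F) (L : V →L[ℝ] Y) (l : ℕ) (x : Lp V 2 μ) :
    diffCoeff (lift μ U) (lift μ W) (lift μ L) l x = lift μ (diffCoeff U W L l) x := by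
  cases l with
  | zero => rfl
  | succ l =>
    simp only [diffCoeff]
    rw [lift_comp, lift_comp, ← lift_coeff]; rfl

/-- A linear combination of the solution that stays bounded in mean square only loads on the
cointegrating combination. -/
theorem StableFactor.eq_zero_of_bounded (h : StableFactor U W T) {e x : ℤ → Lp V 2 μ}
    (he : IsLpWhite e) (hx : SolvesECM (_root_.lift μ U) (_root_.lift μ W) e x) {K : ℝ}
    (hW : ∀ t, ‖_root_.lift μ W (x t)‖ ≤ K) (f : V →L[ℝ] ℝ) {R : ℝ}
    (hR : ∀ t, ‖_root_.lift μ f (x t)‖ ≤ R) {v : V} (hv : W v = 0) : f v = 0 := by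
  -- `g` is `f` after the projection onto `ker W`: it annihilates the feedback, so `g x` is a random
  -- walk in `g e`, and it agrees with `f` on `ker W`.
  set g : V →L[ℝ] ℝ := f - f ∘L U ∘L T ∘L W with hg
  have hgU : g ∘L U = 0 := by
    ext c; simp [hg, h.left]
  have hgx : ∀ t, ‖_root_.lift μ g (x t)‖ ≤ R + ‖_root_.lift μ (f ∘L U ∘L T)‖ * K := fun t => by
    rw [hg, lift_sub]
    refine (norm_sub_le _ _).trans (add_le_add (hR t) ?_)
    rw [show f ∘L U ∘L T ∘L W = (f ∘L U ∘L T) ∘L W from rfl, lift_comp]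
    exact (ContinuousLinearMap.le_opNorm _ _).trans (by gcongr; exact hW t)
  have hstep : ∀ t, _root_.lift μ g (e t) = _root_.lift μ g (x t) - _root_.lift μ g (x (t - 1)) :=
    fun t => by
      rw [← map_sub, hx t, map_add, ← lift_comp, hgU, lift_zero, zero_add]
  have hsum : ∀ N : ℕ, ∑ k ∈ Finset.range N, _root_.lift μ g (e (k + 1))
      = _root_.lift μ g (x N) - _root_.lift μ g (x 0) := fun N => by
    have := Finset.sum_range_sub (fun k : ℕ => _root_.lift μ g (x k)) N
    rw [Nat.cast_zero] at this
    rw [← this]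
    refine Finset.sum_congr rfl fun k _ => ?_
    rw [hstep, add_sub_cancel_right]; push_cast; rfl
  have hg0 : g = 0 := he.eq_zero_of_bounded_sum g fun N => by
    rw [hsum]
    exact (norm_sub_le _ _).trans (add_le_add (hgx _) (hgx _))
  have := congrArg (fun k : V →L[ℝ] ℝ => k v) hg0
  simpa [hg, hv] using this

end LpErrorCorrection

/-! ### Matrices of full column rank -/

section FullRank

theorem isUnit_of_rank_eq {r : ℕ} (A : Matrix (Fin r) (Fin r) ℝ) (hA : A.rank = r) : IsUnit A := by
  rw [← Matrix.mulVec_surjective_iff_isUnit]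
  have : LinearMap.range A.mulVecLin = ⊤ := by
    apply Submodule.eq_top_of_finrank_eq
    rw [Module.finrank_fin_fun]
    exact hA
  exact LinearMap.range_eq_top.1 this

theorem exists_left_inverse_of_rank_eq {m r : ℕ} (A : Matrix (Fin m) (Fin r) ℝ) (hA : A.rank = r) :
    ∃ L : Matrix (Fin r) (Fin m) ℝ, L * A = 1 := by
  have hu : IsUnit (Aᵀ * A) := isUnit_of_rank_eq _ (by rw [rank_transpose_mul_self, hA])
  refine ⟨(Aᵀ * A)⁻¹ * Aᵀ, ?_⟩
  rw [Matrix.mul_assoc, nonsing_inv_mul _ ((isUnit_iff_isUnit_det _).1 hu)]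

theorem exists_ne_zero_transpose_mulVec_eq_zero {n r : ℕ} (hr : r < n)
    (A : Matrix (Fin n) (Fin r) ℝ) : ∃ v : Fin n → ℝ, v ≠ 0 ∧ Aᵀ *ᵥ v = 0 := by
  have h : LinearMap.ker Aᵀ.mulVecLin ≠ ⊥ :=
    LinearMap.ker_ne_bot_of_finrank_lt (by simpa using hr)
  obtain ⟨v, hv, hv0⟩ := Submodule.exists_mem_ne_zero_of_ne_bot h
  exact ⟨v, hv0, hv⟩

end FullRank

/-! ### Two-sided multiplication and its stability -/

section Sandwich

variable {𝕜 : Type*} [RCLike 𝕜] {a b c d : ℕ}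

/-- The map `X ↦ A X B`, on plain arrays, which carry the supremum norm. -/
noncomputable def sandwich (A : Matrix (Fin c) (Fin a) 𝕜) (B : Matrix (Fin b) (Fin d) 𝕜) :
    (Fin a → Fin b → 𝕜) →L[𝕜] (Fin c → Fin d → 𝕜) :=
  LinearMap.toContinuousLinearMap
    { toFun := fun X => of.symm (A * of X * B)
      map_add' := fun X Y => by rw [← of_add_of, Matrix.mul_add, Matrix.add_mul]; rfl
      map_smul' := fun r X => by rw [← smul_of, Matrix.mul_smul, Matrix.smul_mul]; rfl }

theorem of_sandwich (A : Matrix (Fin c) (Fin a) 𝕜) (B : Matrix (Fin b) (Fin d) 𝕜)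
    (X : Fin a → Fin b → 𝕜) : of (sandwich A B X) = A * of X * B := rfl

theorem exists_eigenvector_of_mem_spectrum {E : Type*} [NormedAddCommGroup E] [NormedSpace ℂ E]
    [FiniteDimensional ℂ E] (G : E →L[ℂ] E) {z : ℂ} (hz : z ∈ spectrum ℂ G) :
    ∃ x ≠ 0, G x = z • x := by
  have := FiniteDimensional.complete ℂ E
  by_contra! hne
  apply spectrum.mem_iff.1 hz
  rw [ContinuousLinearMap.isUnit_iff_bijective]
  have hinj : Function.Injective (algebraMap ℂ (E →L[ℂ] E) z - G).toLinearMap := by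
    rw [← LinearMap.ker_eq_bot, LinearMap.ker_eq_bot']
    intro x hx
    by_contra hx0
    refine hne x hx0 ?_
    have : (algebraMap ℂ (E →L[ℂ] E) z) x - G x = 0 := hx
    rw [Algebra.algebraMap_eq_smul_one] at this
    exact (sub_eq_zero.1 this).symm
  exact ⟨hinj, LinearMap.injective_iff_surjective.1 hinj⟩

/-- The spectral bound needs complex scalars, where the spectrum consists of eigenvalues. The
inclusion of real arrays into complex ones keeps the supremum norm and intertwines the powers, so
the bound restricts. -/
theorem powerStable_one_add_sandwich [NeZero a] [NeZero b] (A : Matrix (Fin a) (Fin a) ℝ)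
    (B : Matrix (Fin b) (Fin b) ℝ)
    (h : ∀ (z : ℂ) (x : Matrix (Fin a) (Fin b) ℂ), x ≠ 0 →
      x + A.map (algebraMap ℝ ℂ) * x * B.map (algebraMap ℝ ℂ) = z • x → ‖z‖ < 1) :
    PowerStable (1 + sandwich A B) := by
  set H : (Fin a → Fin b → ℂ) →L[ℂ] (Fin a → Fin b → ℂ) :=
    1 + sandwich (A.map (algebraMap ℝ ℂ)) (B.map (algebraMap ℝ ℂ)) with hH
  obtain ⟨K, ρ, h0, h1, hK⟩ := exists_norm_pow_le_of_spectralRadius_lt_one H fun z hz => by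
    obtain ⟨x, hx, hx2⟩ := exists_eigenvector_of_mem_spectrum H hz
    exact h z (of x) hx (congrArg of hx2)
  let cx : (Fin a → Fin b → ℝ) → Fin a → Fin b → ℂ := fun c i j => algebraMap ℝ ℂ (c i j)
  have hmap : ∀ (k : ℕ) (c : Fin a → Fin b → ℝ),
      (H ^ k) (cx c) = cx (((1 + sandwich A B) ^ k) c) := by
    intro k
    induction k with
    | zero => intro c; rfl
    | succ k ih =>
      intro c
      rw [pow_succ, pow_succ]
      change (H ^ k) (H _) = cx (((1 + sandwich A B) ^ k) ((1 + sandwich A B) c))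
      rw [← ih]
      congr 1
      change (of c).map (algebraMap ℝ ℂ) + A.map (algebraMap ℝ ℂ) * (of c).map (algebraMap ℝ ℂ)
        * B.map (algebraMap ℝ ℂ) = (of c + A * of c * B).map (algebraMap ℝ ℂ)
      rw [Matrix.map_add _ (map_add _), Matrix.map_mul, Matrix.map_mul]
  have hnorm : ∀ c : Fin a → Fin b → ℝ, ‖cx c‖ = ‖c‖ := fun c => by
    simp [cx, Pi.norm_def, Pi.nnnorm_def]
  refine ⟨K, ρ, h0, h1, fun k => ContinuousLinearMap.opNorm_le_bound _
    ((norm_nonneg _).trans (hK k)) fun c => ?_⟩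
  rw [← hnorm, ← hmap, ← hnorm c]
  exact (ContinuousLinearMap.le_opNorm _ _).trans (by gcongr; exact hK k)

end Sandwich

/-! ### Consequences of the `I(1)` condition -/

section MECM

variable {m n r₁ r₂ : ℕ} {τ γ : Matrix (Fin m) (Fin r₁) ℝ} {θ φ : Matrix (Fin n) (Fin r₂) ℝ}

theorem mecmPi_mulVec_vec (τ γ : Matrix (Fin m) (Fin r₁) ℝ) (θ φ : Matrix (Fin n) (Fin r₂) ℝ)
    (x : Matrix (Fin m) (Fin n) ℝ) :
    mecmPi τ γ θ φ *ᵥ vec x = vec (τ * γᵀ * x * (θ * φᵀ)) := by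
  rw [mecmPi, kronecker_mulVec_vec, transpose_mul, transpose_transpose]

theorem mecmPi_map_mulVec_vec (τ γ : Matrix (Fin m) (Fin r₁) ℝ)
    (θ φ : Matrix (Fin n) (Fin r₂) ℝ) (x : Matrix (Fin m) (Fin n) ℂ) :
    (mecmPi τ γ θ φ).map (fun x : ℝ => (x : ℂ)) *ᵥ vec x
      = vec ((τ * γᵀ).map (algebraMap ℝ ℂ) * x * (θ * φᵀ).map (algebraMap ℝ ℂ)) := by
  have : (mecmPi τ γ θ φ).map (fun x : ℝ => (x : ℂ))
      = (φ * θᵀ).map (algebraMap ℝ ℂ) ⊗ₖ (τ * γᵀ).map (algebraMap ℝ ℂ) := by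
    ext i j
    simp [mecmPi, kroneckerMap_apply]
  rw [this, kronecker_mulVec_vec, ← transpose_map, transpose_mul, transpose_transpose]

/-- Semisimplicity of the unit root makes `c ↦ γ'τ c φ'θ` injective. -/
theorem eq_zero_of_semisimple (hτ : τ.rank = r₁) (hγ : γ.rank = r₁) (hθ : θ.rank = r₂)
    (hφ : φ.rank = r₂) (hsemi : SemisimpleUnitRoot τ γ θ φ) {c : Matrix (Fin r₁) (Fin r₂) ℝ}
    (hc : γᵀ * τ * c * (φᵀ * θ) = 0) : c = 0 := by
  obtain ⟨Lτ, hLτ⟩ := exists_left_inverse_of_rank_eq τ hτ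
  obtain ⟨Lγ, hLγ⟩ := exists_left_inverse_of_rank_eq γ hγ
  obtain ⟨Lθ, hLθ⟩ := exists_left_inverse_of_rank_eq θ hθ
  obtain ⟨Lφ, hLφ⟩ := exists_left_inverse_of_rank_eq φ hφ
  have hLγ' : γᵀ * Lγᵀ = 1 := by rw [← transpose_mul, hLγ, transpose_one]
  have hLφ' : φᵀ * Lφᵀ = 1 := by rw [← transpose_mul, hLφ, transpose_one]
  -- A preimage of `c` under `W`. With `N` the feedback `U W`, `N x = U c` and `N² x = U (W U c) =
  -- 0`; semisimplicity gives `U c = 0`, and `U` is injective.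
  set x := Lγᵀ * c * Lθ with hx
  have hWx : γᵀ * x * θ = c := by
    calc γᵀ * (Lγᵀ * c * Lθ) * θ = (γᵀ * Lγᵀ) * c * (Lθ * θ) := by simp only [Matrix.mul_assoc]
      _ = c := by rw [hLγ', hLθ, Matrix.one_mul, Matrix.mul_one]
  set N := Matrix.toLin' (1 + mecmPi τ γ θ φ) - algebraMap ℝ (Module.End ℝ _) 1 with hN
  have hNv : ∀ y : Matrix (Fin m) (Fin n) ℝ, N (vec y) = vec (τ * (γᵀ * y * θ) * φᵀ) := fun y => by
    rw [hN, map_one, LinearMap.sub_apply, Matrix.toLin'_apply, Matrix.add_mulVec, Matrix.one_mulVec,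
      mecmPi_mulVec_vec, Module.End.one_apply, add_sub_cancel_left]
    simp only [Matrix.mul_assoc]
  have h2 : N (N (vec x)) = 0 := by
    rw [hNv, hNv, hWx, vec_eq_zero_iff]
    have : γᵀ * (τ * c * φᵀ) * θ = 0 := by rw [← hc]; simp only [Matrix.mul_assoc]
    rw [this]; simp
  have hmem : vec x ∈ Module.End.maxGenEigenspace (Matrix.toLin' (1 + mecmPi τ γ θ φ)) 1 := by
    rw [Module.End.mem_maxGenEigenspace]
    refine ⟨2, ?_⟩
    rw [pow_two]
    rw [hN, map_one] at h2
    simpa using h2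
  rw [hsemi, Module.End.mem_eigenspace_iff, one_smul] at hmem
  have h3 : N (vec x) = 0 := by
    rw [hN, map_one, LinearMap.sub_apply, hmem]; simp
  rw [hNv, hWx, vec_eq_zero_iff] at h3
  calc c = (Lτ * τ) * c * (φᵀ * Lφᵀ) := by rw [hLτ, hLφ', Matrix.one_mul, Matrix.mul_one]
    _ = Lτ * (τ * c * φᵀ) * Lφᵀ := by simp only [Matrix.mul_assoc]
    _ = 0 := by rw [h3]; simp

/-- A null vector of either factor, paired with an all-ones vector, gives a nonzero rank-one matrix
in the kernel. Both dimensions must be positive for the all-ones vector to be nonzero. -/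
theorem isUnit_of_forall_eq_zero [NeZero r₁] [NeZero r₂] {A : Matrix (Fin r₁) (Fin r₁) ℝ}
    {B : Matrix (Fin r₂) (Fin r₂) ℝ}
    (h : ∀ c : Matrix (Fin r₁) (Fin r₂) ℝ, A * c * B = 0 → c = 0) :
    IsUnit A.det ∧ IsUnit B.det := by
  constructor <;> rw [isUnit_iff_ne_zero] <;> intro hdet
  · obtain ⟨v, hv, hv2⟩ := exists_mulVec_eq_zero_iff.2 hdet
    have := h (vecMulVec v 1) (by rw [mul_vecMulVec, hv2]; simp)
    refine hv (funext fun i => ?_)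
    simpa [vecMulVec_apply] using congrFun (congrFun this i) 0
  · obtain ⟨v, hv, hv2⟩ := exists_vecMul_eq_zero_iff.2 hdet
    have := h (vecMulVec 1 v) (by rw [Matrix.mul_assoc, vecMulVec_mul, hv2]; simp)
    refine hv (funext fun i => ?_)
    simpa [vecMulVec_apply] using congrFun (congrFun this 0) i

/-- `c ↦ τcφ'` carries an eigenvector of `1 + W U` to one of `1 + U W`, so for `z ≠ 0` the
reciprocal `z⁻¹` is a characteristic root. The root one would mean `W U c = 0`, which invertibility
of both factors forbids. -/
theorem norm_lt_one_of_rootCondition (hτ : τ.rank = r₁) (hφ : φ.rank = r₂)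
    (hroot : RootCondition τ γ θ φ) (hΓ : IsUnit (γᵀ * τ).det) (hΦ : IsUnit (φᵀ * θ).det)
    (z : ℂ) (c : Matrix (Fin r₁) (Fin r₂) ℂ) (hc : c ≠ 0)
    (hz : c + (γᵀ * τ).map (algebraMap ℝ ℂ) * c * (φᵀ * θ).map (algebraMap ℝ ℂ) = z • c) :
    ‖z‖ < 1 := by
  obtain ⟨Lτ, hLτ⟩ := exists_left_inverse_of_rank_eq τ hτ
  obtain ⟨Lφ, hLφ⟩ := exists_left_inverse_of_rank_eq φ hφ
  have hLφ' : φᵀ * Lφᵀ = 1 := by rw [← transpose_mul, hLφ, transpose_one]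
  have cm : ∀ {a b c : ℕ} (A : Matrix (Fin a) (Fin b) ℝ) (B : Matrix (Fin b) (Fin c) ℝ),
    A.map (algebraMap ℝ ℂ) * B.map (algebraMap ℝ ℂ) = (A * B).map (algebraMap ℝ ℂ) :=
    fun A B => (Matrix.map_mul).symm
  have cone : ∀ a : ℕ, (1 : Matrix (Fin a) (Fin a) ℝ).map (algebraMap ℝ ℂ) = 1 := fun a => by simp
  rcases eq_or_ne z 0 with rfl | hz0
  · simp
  set x := τ.map (algebraMap ℝ ℂ) * c * φᵀ.map (algebraMap ℝ ℂ) with hx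
  have hcx : Lτ.map (algebraMap ℝ ℂ) * x * Lφᵀ.map (algebraMap ℝ ℂ) = c := by
    calc _ = (Lτ.map (algebraMap ℝ ℂ) * τ.map (algebraMap ℝ ℂ)) * c
          * (φᵀ.map (algebraMap ℝ ℂ) * Lφᵀ.map (algebraMap ℝ ℂ)) := by
          simp only [hx, Matrix.mul_assoc]
      _ = c := by rw [cm, cm, hLτ, hLφ', cone, cone, Matrix.one_mul, Matrix.mul_one]
  have hx0 : x ≠ 0 := fun h => hc (by rw [← hcx, h]; simp)
  have hPx : (τ * γᵀ).map (algebraMap ℝ ℂ) * x * (θ * φᵀ).map (algebraMap ℝ ℂ) = (z - 1) • x := by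
    calc _ = τ.map (algebraMap ℝ ℂ) * ((γᵀ * τ).map (algebraMap ℝ ℂ) * c
          * (φᵀ * θ).map (algebraMap ℝ ℂ)) * φᵀ.map (algebraMap ℝ ℂ) := by
          simp only [hx, ← cm, Matrix.mul_assoc]
      _ = τ.map (algebraMap ℝ ℂ) * ((z - 1) • c) * φᵀ.map (algebraMap ℝ ℂ) := by
          rw [sub_smul, one_smul, ← hz, add_sub_cancel_left]
      _ = _ := by rw [Matrix.mul_smul, Matrix.smul_mul]
  have hdet : (mecmChar τ γ θ φ z⁻¹).det = 0 := by
    refine exists_mulVec_eq_zero_iff.1 ⟨vec x, by rwa [Ne, vec_eq_zero_iff], ?_⟩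
    rw [mecmChar, Matrix.sub_mulVec, Matrix.smul_mulVec, Matrix.smul_mulVec, Matrix.one_mulVec,
      mecmPi_map_mulVec_vec, hPx, vec_smul, smul_smul, ← sub_smul]
    have : 1 - z⁻¹ - z⁻¹ * (z - 1) = 0 := by field_simp; ring
    rw [this, zero_smul]
  rcases hroot _ hdet with h | h
  · rw [norm_inv] at h
    exact (one_lt_inv₀ (norm_pos_iff.2 hz0)).1 h
  · exfalso
    have hz1 : z = 1 := by simpa using h
    rw [hz1, one_smul, add_eq_left] at hz
    apply hc
    calc c = ((γᵀ * τ)⁻¹.map (algebraMap ℝ ℂ) * (γᵀ * τ).map (algebraMap ℝ ℂ)) * c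
          * ((φᵀ * θ).map (algebraMap ℝ ℂ) * (φᵀ * θ)⁻¹.map (algebraMap ℝ ℂ)) := by
          rw [cm, cm, nonsing_inv_mul _ hΓ, mul_nonsing_inv _ hΦ, cone, cone, Matrix.one_mul,
            Matrix.mul_one]
      _ = (γᵀ * τ)⁻¹.map (algebraMap ℝ ℂ) * ((γᵀ * τ).map (algebraMap ℝ ℂ) * c
          * (φᵀ * θ).map (algebraMap ℝ ℂ)) * (φᵀ * θ)⁻¹.map (algebraMap ℝ ℂ) := by
          simp only [Matrix.mul_assoc]
      _ = 0 := by rw [hz]; simp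

/-- The `I(1)` condition makes the matrix error correction model a stable one. -/
theorem stableFactor_mecm (hr₁ : 0 < r₁) (hr₂ : 0 < r₂) (hτ : τ.rank = r₁) (hγ : γ.rank = r₁)
    (hθ : θ.rank = r₂) (hφ : φ.rank = r₂) (hroot : RootCondition τ γ θ φ)
    (hsemi : SemisimpleUnitRoot τ γ θ φ) :
    StableFactor (sandwich τ φᵀ) (sandwich γᵀ θ) (sandwich (γᵀ * τ)⁻¹ (φᵀ * θ)⁻¹) := by
  have : NeZero r₁ := ⟨hr₁.ne'⟩
  have : NeZero r₂ := ⟨hr₂.ne'⟩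
  obtain ⟨hΓ, hΦ⟩ := isUnit_of_forall_eq_zero
    fun c hc => eq_zero_of_semisimple hτ hγ hθ hφ hsemi hc
  refine ⟨fun c => ?_, fun c => ?_, ?_⟩
  · apply of.injective
    simp only [of_sandwich]
    calc _ = ((γᵀ * τ)⁻¹ * (γᵀ * τ)) * of c * ((φᵀ * θ) * (φᵀ * θ)⁻¹) := by
          simp only [Matrix.mul_assoc]
      _ = of c := by rw [nonsing_inv_mul _ hΓ, mul_nonsing_inv _ hΦ, Matrix.one_mul, Matrix.mul_one]
  · apply of.injective
    simp only [of_sandwich]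
    calc _ = ((γᵀ * τ) * (γᵀ * τ)⁻¹) * of c * ((φᵀ * θ)⁻¹ * (φᵀ * θ)) := by
          simp only [Matrix.mul_assoc]
      _ = of c := by rw [mul_nonsing_inv _ hΓ, nonsing_inv_mul _ hΦ, Matrix.one_mul, Matrix.mul_one]
  · have : sandwich γᵀ θ ∘L sandwich τ φᵀ = sandwich (γᵀ * τ) (φᵀ * θ) := by
      ext1 c
      apply of.injective
      simp only [ContinuousLinearMap.comp_apply, of_sandwich, Matrix.mul_assoc]
    rw [this]
    exact powerStable_one_add_sandwich _ _ (norm_lt_one_of_rootCondition hτ hφ hroot hΓ hΦ)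

end MECM

/-! ### Random matrices as elements of `L²` -/

section MatrixProcess

variable {Ω : Type*} [MeasurableSpace Ω] {μ : Measure Ω} {a b p q : ℕ}

theorem exists_forall_le (g : Fin a → Fin b → ℝ) : ∃ D, ∀ i j, g i j ≤ D := by
  obtain ⟨D, hD⟩ := (Set.finite_range fun r : Fin a × Fin b => g r.1 r.2).bddAbove
  exact ⟨D, fun i j => hD ⟨(i, j), rfl⟩⟩

theorem memLp_array {X : Ω → Matrix (Fin a) (Fin b) ℝ}
    (hX : ∀ i j, MemLp (fun ω => X ω i j) 2 μ) :
    MemLp (fun ω => (fun i j => X ω i j : Fin a → Fin b → ℝ)) 2 μ :=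
  memLp_pi_iff.2 fun i => memLp_pi_iff.2 fun j => hX i j

/-- A square-integrable random matrix as an element of `L²`. -/
noncomputable def toL2 (X : Ω → Matrix (Fin a) (Fin b) ℝ)
    (hX : ∀ i j, MemLp (fun ω => X ω i j) 2 μ) : Lp (Fin a → Fin b → ℝ) 2 μ :=
  (memLp_array hX).toLp

theorem coeFn_toL2 {X : Ω → Matrix (Fin a) (Fin b) ℝ}
    (hX : ∀ i j, MemLp (fun ω => X ω i j) 2 μ) :
    ∀ᵐ ω ∂μ, of (toL2 X hX ω) = X ω :=
  (memLp_array hX).coeFn_toLp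

/-- The `(i, j)` entry as a continuous linear functional. -/
noncomputable def entry (i : Fin a) (j : Fin b) : (Fin a → Fin b → ℝ) →L[ℝ] ℝ :=
  ContinuousLinearMap.proj j ∘L ContinuousLinearMap.proj (φ := fun _ : Fin a => Fin b → ℝ) i

theorem memLp_entry (x : Lp (Fin a → Fin b → ℝ) 2 μ) (i : Fin a) (j : Fin b) :
    MemLp (fun ω => x ω i j) 2 μ :=
  memLp_pi_iff.1 (memLp_pi_iff.1 (Lp.memLp x) i) j

theorem lift_entry_toL2 {X : Ω → Matrix (Fin a) (Fin b) ℝ}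
    (hX : ∀ i j, MemLp (fun ω => X ω i j) 2 μ) (i : Fin a) (j : Fin b) :
    lift μ (entry i j) (toL2 X hX) = (hX i j).toLp (fun ω => X ω i j) :=
  lift_toLp _ (memLp_array hX)

theorem memLp_sandwich {X : Ω → Matrix (Fin a) (Fin b) ℝ}
    (hX : ∀ i j, MemLp (fun ω => X ω i j) 2 μ) {c d : ℕ} (A : Matrix (Fin c) (Fin a) ℝ)
    (B : Matrix (Fin b) (Fin d) ℝ) (i : Fin c) (j : Fin d) :
    MemLp (fun ω => (A * X ω * B) i j) 2 μ :=
  (entry i j ∘L sandwich A B).comp_memLp' (memLp_array hX)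

theorem lift_sandwich_toL2 {X : Ω → Matrix (Fin a) (Fin b) ℝ}
    (hX : ∀ i j, MemLp (fun ω => X ω i j) 2 μ) {c d : ℕ} (A : Matrix (Fin c) (Fin a) ℝ)
    (B : Matrix (Fin b) (Fin d) ℝ) :
    lift μ (sandwich A B) (toL2 X hX) = toL2 (fun ω => A * X ω * B) (memLp_sandwich hX A B) :=
  lift_toLp _ (memLp_array hX)

theorem toL2_sub {X Y : Ω → Matrix (Fin a) (Fin b) ℝ}
    (hX : ∀ i j, MemLp (fun ω => X ω i j) 2 μ) (hY : ∀ i j, MemLp (fun ω => Y ω i j) 2 μ)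
    (hXY : ∀ i j, MemLp (fun ω => (X ω - Y ω) i j) 2 μ) :
    toL2 (fun ω => X ω - Y ω) hXY = toL2 X hX - toL2 Y hY :=
  MemLp.toLp_sub (memLp_array hX) (memLp_array hY)

theorem norm_lift_entry (x : Lp (Fin a → Fin b → ℝ) 2 μ) (i : Fin a) (j : Fin b) :
    ‖lift μ (entry i j) x‖ₑ = eLpNorm (fun ω => x ω i j) 2 μ := by
  rw [Lp.enorm_def]
  exact eLpNorm_congr_ae ((entry i j).coeFn_compLpL (p := 2) x)

theorem eLpNorm_entry_le (x : Lp (Fin a → Fin b → ℝ) 2 μ) (i : Fin a) (j : Fin b) :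
    eLpNorm (fun ω => x ω i j) 2 μ ≤ ‖x‖ₑ := by
  rw [Lp.enorm_def]
  exact eLpNorm_mono fun ω => (norm_le_pi_norm (x ω i) j).trans (norm_le_pi_norm (x ω) i)

theorem tendsto_eLpNorm_entry {x : ℕ → Lp (Fin a → Fin b → ℝ) 2 μ} (hx : Tendsto x atTop (𝓝 0))
    {f : ℕ → Ω → Matrix (Fin a) (Fin b) ℝ} (hf : ∀ N, ∀ᵐ ω ∂μ, f N ω = of (x N ω)) (i : Fin a)
    (j : Fin b) : Tendsto (fun N => eLpNorm (fun ω => f N ω i j) 2 μ) atTop (𝓝 0) := by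
  have h1 : Tendsto (fun N => ‖x N‖ₑ) atTop (𝓝 0) := by simpa using hx.enorm
  refine tendsto_of_tendsto_of_tendsto_of_le_of_le tendsto_const_nhds h1 (fun _ => zero_le)
    fun N => ?_
  refine (eLpNorm_congr_ae ?_).trans_le (eLpNorm_entry_le (x N) i j)
  filter_upwards [hf N] with ω h
  rw [h]; rfl

theorem array_eq_sum_single (x : Fin a → Fin b → ℝ) :
    x = ∑ r : Fin a × Fin b, x r.1 r.2 • Pi.single r.1 (Pi.single r.2 1) := by
  ext i j
  rw [Finset.sum_apply, Finset.sum_apply, Finset.sum_eq_single (i, j)]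
  · simp
  · rintro ⟨k, l⟩ - hr
    rcases eq_or_ne i k with rfl | hik
    · have hjl : j ≠ l := fun h => hr (by rw [h])
      simp [hjl]
    · simp [hik]
  · simp

theorem eq_sum_entry (f : (Fin a → Fin b → ℝ) →L[ℝ] ℝ) :
    f = ∑ r : Fin a × Fin b, f (Pi.single r.1 (Pi.single r.2 1)) • entry r.1 r.2 := by
  ext1 x
  conv_lhs => rw [array_eq_sum_single x]
  rw [map_sum, _root_.sum_apply]
  refine Finset.sum_congr rfl fun r _ => ?_
  rw [map_smul, smul_eq_mul, mul_comm]; rfl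

theorem lift_eq_sum_entry (f : (Fin a → Fin b → ℝ) →L[ℝ] ℝ) (x : Lp (Fin a → Fin b → ℝ) 2 μ) :
    lift μ f x = ∑ r : Fin a × Fin b,
      f (Pi.single r.1 (Pi.single r.2 1)) • lift μ (entry r.1 r.2) x := by
  conv_lhs => rw [eq_sum_entry f]
  rw [lift_sum]
  simp_rw [lift_smul]

theorem exists_norm_le_of_entry_le (μ : Measure Ω) (a b : ℕ) (R : ℝ) :
    ∃ R', ∀ x : Lp (Fin a → Fin b → ℝ) 2 μ, (∀ i j, ‖lift μ (entry i j) x‖ ≤ R) → ‖x‖ ≤ R' := by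
  let s : Fin a × Fin b → ℝ →L[ℝ] (Fin a → Fin b → ℝ) := fun r =>
    ContinuousLinearMap.toSpanSingleton ℝ (Pi.single r.1 (Pi.single r.2 1))
  have hid : ContinuousLinearMap.id ℝ (Fin a → Fin b → ℝ) = ∑ r, s r ∘L entry r.1 r.2 := by
    ext1 x
    rw [_root_.sum_apply]
    exact array_eq_sum_single x
  refine ⟨∑ r, ‖lift μ (s r)‖ * R, fun x hx => ?_⟩
  rw [← lift_id x, hid, lift_sum]
  refine (norm_sum_le _ _).trans (Finset.sum_le_sum fun r _ => ?_)
  rw [lift_comp]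
  exact (ContinuousLinearMap.le_opNorm _ _).trans (by gcongr; exact hx _ _)

theorem inner_lift_entry_toL2 {X Y : Ω → Matrix (Fin a) (Fin b) ℝ}
    (hX : ∀ i j, MemLp (fun ω => X ω i j) 2 μ) (hY : ∀ i j, MemLp (fun ω => Y ω i j) 2 μ)
    (i k : Fin a) (j l : Fin b) :
    inner ℝ (lift μ (entry i j) (toL2 X hX)) (lift μ (entry k l) (toL2 Y hY))
      = ∫ ω, X ω i j * Y ω k l ∂μ := by
  rw [lift_entry_toL2, lift_entry_toL2, L2.inner_def]
  refine integral_congr_ae ?_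
  filter_upwards [(hX i j).coeFn_toLp, (hY k l).coeFn_toLp] with ω h1 h2
  rw [h1, h2, real_inner_eq_re_inner]
  simp [mul_comm]

theorem IsWhiteNoise.isLpWhite [IsFiniteMeasure μ] {E : ℤ → Ω → Matrix (Fin a) (Fin b) ℝ}
    {S : Matrix (Fin a × Fin b) (Fin a × Fin b) ℝ} (hE : IsWhiteNoise μ E S) (hS : S.PosDef) :
    IsLpWhite fun t => toL2 (E t) (hE.memLp t) := by
  have hinner : ∀ s t (f g : (Fin a → Fin b → ℝ) →L[ℝ] ℝ),
      inner ℝ (lift μ f (toL2 (E s) (hE.memLp s))) (lift μ g (toL2 (E t) (hE.memLp t)))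
      = ∑ r : Fin a × Fin b, ∑ r' : Fin a × Fin b,
        f (Pi.single r.1 (Pi.single r.2 1)) * (g (Pi.single r'.1 (Pi.single r'.2 1))
          * ∫ ω, E s ω r.1 r.2 * E t ω r'.1 r'.2 ∂μ) := by
    intro s t f g
    rw [lift_eq_sum_entry f, lift_eq_sum_entry g, sum_inner]
    refine Finset.sum_congr rfl fun r _ => ?_
    rw [inner_sum]
    refine Finset.sum_congr rfl fun r' _ => ?_
    rw [real_inner_smul_left, real_inner_smul_right, inner_lift_entry_toL2]
  refine ⟨?_, fun t f => ?_, fun s t f g => ?_, fun s t hst f g => ?_, fun f hf => ?_⟩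
  · obtain ⟨D, hD⟩ := exists_forall_le fun i j => √(S (i, j) (i, j))
    obtain ⟨R, hR⟩ := exists_norm_le_of_entry_le μ a b D
    refine ⟨R, fun t => hR _ fun i j => ?_⟩
    have h1 : ‖lift μ (entry i j) (toL2 (E t) (hE.memLp t))‖ = √(S (i, j) (i, j)) := by
      rw [← hE.cov_same t, ← inner_lift_entry_toL2 (hE.memLp t) (hE.memLp t),
        real_inner_self_eq_norm_sq, Real.sqrt_sq (norm_nonneg _)]
    rw [h1]
    exact hD i j
  · have hae : (fun ω => lift μ f (toL2 (E t) (hE.memLp t)) ω) =ᵐ[μ] fun ω =>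
        ∑ r : Fin a × Fin b, f (Pi.single r.1 (Pi.single r.2 1)) * E t ω r.1 r.2 := by
      filter_upwards [f.coeFn_compLpL (p := 2) (toL2 (E t) (hE.memLp t)),
        coeFn_toL2 (hE.memLp t)] with ω h1 h2
      rw [h1]
      conv_lhs => rw [eq_sum_entry f]
      rw [_root_.sum_apply]
      refine Finset.sum_congr rfl fun r _ => ?_
      change _ * of (toL2 (E t) (hE.memLp t) ω) r.1 r.2 = _
      rw [h2]
    rw [integral_congr_ae hae, integral_finsetSum _ fun r _ =>
      ((hE.memLp t _ _).integrable one_le_two).const_mul _]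
    refine Finset.sum_eq_zero fun r _ => ?_
    rw [integral_const_mul, hE.mean, mul_zero]
  · rw [hinner, hinner]
    simp_rw [hE.cov_same]
  · rw [hinner]
    simp_rw [hE.cov_ne s t hst]
    simp
  -- With `v` the coefficients of `f`, the second moment of `f(E_0)` is `v'Sv`; if it is zero,
  -- positive definiteness kills `v`.
  · set v : Fin a × Fin b → ℝ := fun r => f (Pi.single r.1 (Pi.single r.2 1)) with hv
    have h0 : v ⬝ᵥ S *ᵥ v = 0 := by
      have := hinner 0 0 f f
      rw [hf, inner_zero_left] at this
      simp_rw [hE.cov_same] at this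
      rw [this]
      simp only [dotProduct, mulVec, Finset.mul_sum]
      refine Finset.sum_congr rfl fun r _ => Finset.sum_congr rfl fun r' _ => ?_
      simp only [hv]; ring
    have hv0 : v = 0 := by
      by_contra hne
      have := hS.dotProduct_mulVec_pos hne
      simp [h0] at this
    rw [eq_sum_entry f]
    exact Finset.sum_eq_zero fun r _ => by
      have : f (Pi.single r.1 (Pi.single r.2 1)) = 0 := congrFun hv0 r
      rw [this, zero_smul]

end MatrixProcess

/-! ### Linear processes: `I(0)`, stationarity and boundedness -/

section LinearProcess

variable {Ω : Type*} [MeasurableSpace Ω] {μ : Measure Ω} {a b p q : ℕ}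
  {E : ℤ → Ω → Matrix (Fin a) (Fin b) ℝ} {S : Matrix (Fin a × Fin b) (Fin a × Fin b) ℝ}
  {Y : ℤ → Ω → Matrix (Fin p) (Fin q) ℝ} {C : ℕ → (Fin a → Fin b → ℝ) →L[ℝ] (Fin p → Fin q → ℝ)}

/-- A map of arrays as a map of matrices. -/
def matrixMap (L : (Fin a → Fin b → ℝ) →L[ℝ] (Fin p → Fin q → ℝ)) :
    Matrix (Fin a) (Fin b) ℝ →ₗ[ℝ] Matrix (Fin p) (Fin q) ℝ :=
  (ofLinearEquiv ℝ).toLinearMap ∘ₗ L.toLinearMap ∘ₗ (ofLinearEquiv ℝ).symm.toLinearMap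

theorem abs_matrixMap_single_le (L : (Fin a → Fin b → ℝ) →L[ℝ] (Fin p → Fin q → ℝ)) (c : Fin a)
    (d : Fin b) (i : Fin p) (j : Fin q) : |matrixMap L (Matrix.single c d 1) i j| ≤ ‖L‖ := by
  have hs : ‖of.symm (Matrix.single c d (1 : ℝ))‖ ≤ 1 := by
    refine (pi_norm_le_iff_of_nonneg zero_le_one).2 fun k =>
      (pi_norm_le_iff_of_nonneg zero_le_one).2 fun l => ?_
    rw [of_symm_apply, Matrix.single_apply]
    split_ifs <;> simp
  refine ((norm_le_pi_norm (L (of.symm (Matrix.single c d 1)) i) j).trans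
    (norm_le_pi_norm _ i)).trans ((L.le_opNorm _).trans ?_)
  exact mul_le_of_le_one_right (norm_nonneg _) hs

/-- A causal linear process in white noise is `I(0)`. -/
theorem isI0_of_hasSum (hE : IsWhiteNoise μ E S) (hS : S.PosDef)
    (hY : ∀ t i j, MemLp (fun ω => Y t ω i j) 2 μ)
    (hC : ∃ K ρ : ℝ, 0 ≤ ρ ∧ ρ < 1 ∧ ∀ l, ‖C l‖ ≤ K * ρ ^ l)
    (hne : ∃ v w, HasSum (fun l => C l v) w ∧ w ≠ 0)
    (hw : ∀ t : ℤ, HasSum (fun l : ℕ => lift μ (C l) (toL2 (E (t - l)) (hE.memLp (t - l))))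
      (toL2 (Y t) (hY t))) : IsI0 μ Y := by
  refine ⟨hY, a, b, E, S, 0, fun l => matrixMap (C l), hE, hS, ?_, ?_, fun t i j => ?_⟩
  · obtain ⟨K, ρ, h0, h1, hK⟩ := hC
    exact ⟨K, ρ, h0, h1, fun l c d i j => (abs_matrixMap_single_le (C l) c d i j).trans (hK l)⟩
  · obtain ⟨v, w, hvw, hw0⟩ := hne
    obtain ⟨i, hi⟩ := Function.ne_iff.1 hw0
    obtain ⟨j, hj⟩ := Function.ne_iff.1 hi
    refine ⟨of v, i, j, ?_⟩
    have := (Pi.hasSum.1 (Pi.hasSum.1 hvw i) j).tsum_eq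
    change ∑' l, C l v i j ≠ 0
    rw [this]
    exact hj
  · have h1 : Tendsto (fun N : ℕ => toL2 (Y t) (hY t) - ∑ l ∈ Finset.range N,
        lift μ (C l) (toL2 (E (t - l)) (hE.memLp (t - l)))) atTop (𝓝 0) := by
      simpa using (hw t).tendsto_sum_nat.const_sub (toL2 (Y t) (hY t))
    refine tendsto_eLpNorm_entry h1 (fun N => ?_) i j
    have h2 : ∀ᵐ ω ∂μ, ∀ l : ℕ, lift μ (C l) (toL2 (E (t - l)) (hE.memLp (t - l))) ω
        = C l (of.symm (E (t - l) ω)) := ae_all_iff.2 fun l => by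
      filter_upwards [(C l).coeFn_compLpL (p := 2) (toL2 (E (t - l)) (hE.memLp (t - l))),
        coeFn_toL2 (hE.memLp (t - l))] with ω h3 h4
      rw [h3, ← h4]; rfl
    filter_upwards [h2, coeFn_toL2 (hY t), Lp.coeFn_sub (toL2 (Y t) (hY t))
        (∑ l ∈ Finset.range N, lift μ (C l) (toL2 (E (t - l)) (hE.memLp (t - l)))),
      Lp.coeFn_finsetSum (Finset.range N) fun l : ℕ =>
        lift μ (C l) (toL2 (E (t - l)) (hE.memLp (t - l)))] with ω h3 h4 h5 h6
    rw [h5, Pi.sub_apply, h6, sub_zero, ← h4]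
    ext k k'
    rw [Matrix.sub_apply, Matrix.sum_apply, of_apply, of_apply, Pi.sub_apply, Pi.sub_apply,
      Finset.sum_apply, Finset.sum_apply, Finset.sum_apply]
    congr 1
    exact Finset.sum_congr rfl fun l _ => congrFun (congrFun (h3 l).symm k) k'

variable [IsProbabilityMeasure μ]

/-- A causal linear process in white noise is weakly stationary. -/
theorem isWeaklyStationary_of_hasSum (hE : IsWhiteNoise μ E S) (hS : S.PosDef)
    (hY : ∀ t i j, MemLp (fun ω => Y t ω i j) 2 μ)
    (hw : ∀ t : ℤ, HasSum (fun l : ℕ => lift μ (C l) (toL2 (E (t - l)) (hE.memLp (t - l))))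
      (toL2 (Y t) (hY t))) : IsWeaklyStationary μ Y := by
  have hW := hE.isLpWhite hS
  have hmean : ∀ t i j, ∫ ω, Y t ω i j ∂μ = 0 := fun t i j => by
    rw [← hW.mean_linear (hw t) (entry i j)]
    refine integral_congr_ae ?_
    rw [lift_entry_toL2]
    exact (hY t i j).coeFn_toLp.symm
  refine ⟨hY, fun t h i j => by rw [hmean, hmean], fun s t h i j k l => ?_⟩
  rw [covariance_eq_sub (hY _ _ _) (hY _ _ _), covariance_eq_sub (hY _ _ _) (hY _ _ _)]
  simp only [hmean, Pi.mul_apply]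
  congr 1
  have := hW.inner_linear_shift hw s t h (entry i j) (entry k l)
  rwa [inner_lift_entry_toL2, inner_lift_entry_toL2] at this

/-- The entries of an `I(0)` process are bounded in mean square. -/
theorem IsI0.exists_norm_le (h : IsI0 μ Y) (hY : ∀ t i j, MemLp (fun ω => Y t ω i j) 2 μ) :
    ∃ R, ∀ t, ‖toL2 (Y t) (hY t)‖ ≤ R := by
  obtain ⟨-, a, b, ε, S, M, C, hε, hS, ⟨K, ρ, h0, h1, hK⟩, -, hlim⟩ := h
  obtain ⟨c, hc⟩ := (hε.isLpWhite hS).bdd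
  have hεc : ∀ t k l, eLpNorm (fun ω => ε t ω k l) 2 μ ≤ ENNReal.ofReal c := fun t k l => by
    rw [← eLpNorm_congr_ae (hε.memLp t k l).coeFn_toLp, ← Lp.enorm_def, ← lift_entry_toL2,
      norm_lift_entry]
    refine (eLpNorm_entry_le _ _ _).trans ?_
    rw [← ofReal_norm]
    exact ENNReal.ofReal_le_ofReal (hc t)
  have hterm : ∀ t l i j, MemLp (fun ω => C l (ε t ω) i j) 2 μ ∧
      eLpNorm (fun ω => C l (ε t ω) i j) 2 μ
        ≤ ∑ _r : Fin a × Fin b, ENNReal.ofReal (K * ρ ^ l) * ENNReal.ofReal c := by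
    intro t l i j
    have heq : (fun ω => C l (ε t ω) i j) = ∑ r : Fin a × Fin b,
        (C l (Matrix.single r.1 r.2 1) i j) • fun ω => ε t ω r.1 r.2 := by
      ext ω
      conv_lhs => rw [matrix_eq_sum_single (ε t ω)]
      rw [Finset.sum_apply, Fintype.sum_prod_type]
      simp only [map_sum, Matrix.sum_apply, Pi.smul_apply, smul_eq_mul]
      refine Finset.sum_congr rfl fun k _ => Finset.sum_congr rfl fun k' _ => ?_
      have : Matrix.single k k' (ε t ω k k') = ε t ω k k' • Matrix.single k k' (1 : ℝ) := by
        simp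
      rw [this, map_smul, Matrix.smul_apply, smul_eq_mul, mul_comm]
    have hmem : ∀ r : Fin a × Fin b,
        MemLp ((C l (Matrix.single r.1 r.2 1) i j) • fun ω => ε t ω r.1 r.2) 2 μ :=
      fun r => (hε.memLp t r.1 r.2).const_smul _
    rw [heq]
    refine ⟨memLp_finsetSum' _ fun r _ => hmem r,
      (eLpNorm_sum_le (fun r _ => (hmem r).1) one_le_two).trans (Finset.sum_le_sum fun r _ => ?_)⟩
    rw [eLpNorm_const_smul]
    refine mul_le_mul' ?_ (hεc _ _ _)
    rw [← ofReal_norm]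
    exact ENNReal.ofReal_le_ofReal (hK l _ _ i j)
  set D : ENNReal := ∑ _r : Fin a × Fin b, (∑' l : ℕ, ENNReal.ofReal (K * ρ ^ l)) * ENNReal.ofReal c
  have hDtop : D ≠ ⊤ := by
    refine ENNReal.sum_ne_top.2 fun _ _ => ENNReal.mul_ne_top ?_ ENNReal.ofReal_ne_top
    exact (((summable_geometric_of_lt_one h0 h1).mul_left K).tsum_ofReal_ne_top)
  obtain ⟨m, hm⟩ := exists_forall_le fun i j => |M i j|
  have hbound : ∀ t i j, eLpNorm (fun ω => Y t ω i j) 2 μ ≤ 1 + ENNReal.ofReal m + D := by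
    intro t i j
    -- One truncation with remainder below `1` is enough. `N` depends on `t`, but the geometric
    -- bound `D` covers every truncation at every time.
    obtain ⟨N, hN⟩ := ((hlim t i j).eventually_lt_const zero_lt_one).exists
    have hsumMem : MemLp (fun ω => ∑ l ∈ Finset.range N, C l (ε (t - l) ω) i j) 2 μ :=
      memLp_finsetSum _ fun l _ => (hterm (t - l) l i j).1
    have hconst : MemLp (fun _ : Ω => M i j) 2 μ := memLp_const _
    have hsplit : (fun ω => Y t ω i j) = (fun ω => (Y t ω - M - ∑ l ∈ Finset.range N,
        C l (ε (t - (l : ℤ)) ω)) i j) + (fun _ : Ω => M i j)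
        + fun ω => ∑ l ∈ Finset.range N, C l (ε (t - l) ω) i j := by
      ext ω
      simp only [Pi.add_apply, Matrix.sub_apply, Matrix.sum_apply]
      ring
    have hresid : MemLp (fun ω => (Y t ω - M - ∑ l ∈ Finset.range N,
        C l (ε (t - (l : ℤ)) ω)) i j) 2 μ := by
      simp only [Matrix.sub_apply, Matrix.sum_apply]
      exact ((hY t i j).sub hconst).sub hsumMem
    rw [hsplit]
    refine (eLpNorm_add_le (hresid.add hconst).1 hsumMem.1 one_le_two).trans
      (add_le_add ((eLpNorm_add_le hresid.1 hconst.1 one_le_two).trans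
        (add_le_add hN.le ?_)) ?_)
    · rw [eLpNorm_const _ two_ne_zero (IsProbabilityMeasure.ne_zero μ)]
      simp only [measure_univ, ENNReal.one_rpow, mul_one]
      rw [← ofReal_norm]
      exact ENNReal.ofReal_le_ofReal (hm i j)
    · have : (fun ω => ∑ l ∈ Finset.range N, C l (ε (t - l) ω) i j)
          = ∑ l ∈ Finset.range N, fun ω => C l (ε (t - l) ω) i j := by
        ext ω; rw [Finset.sum_apply]
      rw [this]
      refine (eLpNorm_sum_le (fun (l : ℕ) _ => (hterm (t - l) l i j).1.1) one_le_two).trans ?_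
      refine (Finset.sum_le_sum fun (l : ℕ) _ => (hterm (t - l) l i j).2).trans ?_
      rw [Finset.sum_comm]
      refine Finset.sum_le_sum fun r _ => ?_
      rw [← Finset.sum_mul]
      gcongr
      exact ENNReal.sum_le_tsum _
  obtain ⟨R, hR⟩ := exists_norm_le_of_entry_le μ p q (1 + ENNReal.ofReal m + D).toReal
  refine ⟨R, fun t => hR _ fun i j => ?_⟩
  rw [lift_entry_toL2, Lp.norm_toLp]
  exact ENNReal.toReal_mono (by finiteness) (hbound t i j)

end LinearProcess

/-! ### Solutions of the matrix model -/

section Solutions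

variable {Ω : Type*} [MeasurableSpace Ω] {μ : Measure Ω} {m n r₁ r₂ : ℕ}
  {τ γ : Matrix (Fin m) (Fin r₁) ℝ} {θ φ : Matrix (Fin n) (Fin r₂) ℝ}
  {E X : ℤ → Ω → Matrix (Fin m) (Fin n) ℝ} {S : Matrix (Fin m × Fin n) (Fin m × Fin n) ℝ}

theorem coeFn_lift_feedback (τ γ : Matrix (Fin m) (Fin r₁) ℝ) (θ φ : Matrix (Fin n) (Fin r₂) ℝ)
    (x : Lp (Fin m → Fin n → ℝ) 2 μ) :
    ∀ᵐ ω ∂μ, of (lift μ (sandwich τ φᵀ) (lift μ (sandwich γᵀ θ) x) ω)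
      = τ * γᵀ * of (x ω) * θ * φᵀ := by
  filter_upwards [(sandwich τ φᵀ).coeFn_compLpL (p := 2) (lift μ (sandwich γᵀ θ) x),
    (sandwich γᵀ θ).coeFn_compLpL (p := 2) x] with ω h1 h2
  rw [h1, h2, of_sandwich, of_sandwich]
  simp only [Matrix.mul_assoc]

theorem IsMECM.solvesECM (hE : IsWhiteNoise μ E S) (hX : IsMECM μ τ γ θ φ E X) :
    SolvesECM (lift μ (sandwich τ φᵀ)) (lift μ (sandwich γᵀ θ))
      (fun t => toL2 (E t) (hE.memLp t)) fun t => toL2 (X t) (hX.memLp t) := by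
  intro t
  apply Lp.ext
  filter_upwards [hX.eqn t, coeFn_toL2 (hE.memLp t), coeFn_toL2 (hX.memLp t),
    coeFn_toL2 (hX.memLp (t - 1)), coeFn_lift_feedback τ γ θ φ (toL2 _ (hX.memLp (t - 1))),
    Lp.coeFn_sub (toL2 _ (hX.memLp t)) (toL2 _ (hX.memLp (t - 1))),
    Lp.coeFn_add (lift μ (sandwich τ φᵀ) (lift μ (sandwich γᵀ θ) (toL2 _ (hX.memLp (t - 1)))))
      (toL2 _ (hE.memLp t))] with ω h1 h2 h3 h4 h5 h6 h7
  rw [h6, h7]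
  apply of.injective
  rw [Pi.sub_apply, Pi.add_apply, ← of_sub_of, ← of_add_of, h2, h3, h4, h5, h4, h1]

theorem IsMECM.exists_norm_past_le (hX : IsMECM μ τ γ θ φ E X) :
    ∃ R, ∀ t ≤ 0, ‖toL2 (X t) (hX.memLp t) - toL2 (X (t - 1)) (hX.memLp (t - 1))‖ ≤ R := by
  obtain ⟨K, hK⟩ := hX.past
  obtain ⟨R, hR⟩ := exists_norm_le_of_entry_le μ m n K
  have hmem : ∀ t i j, MemLp (fun ω => (X t ω - X (t - 1) ω) i j) 2 μ := fun t i j =>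
    (hX.memLp t i j).sub (hX.memLp (t - 1) i j)
  refine ⟨R, fun t ht => ?_⟩
  rw [← toL2_sub (hX.memLp t) (hX.memLp (t - 1)) (hmem t)]
  refine hR _ fun i j => ?_
  rw [lift_entry_toL2, Lp.norm_toLp]
  exact ENNReal.toReal_mono ENNReal.coe_ne_top (hK t ht i j)

theorem exists_solution_of_lp (hE : IsWhiteNoise μ E S) {x : ℤ → Lp (Fin m → Fin n → ℝ) 2 μ}
    (hx : SolvesECM (lift μ (sandwich τ φᵀ)) (lift μ (sandwich γᵀ θ))
      (fun t => toL2 (E t) (hE.memLp t)) x) (hR : ∃ R, ∀ t, ‖x t - x (t - 1)‖ ≤ R) :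
    IsMECM μ τ γ θ φ E fun t ω => of (x t ω) := by
  refine ⟨fun t => memLp_entry (x t), fun t => ?_, ?_⟩
  · have ht := hx t
    filter_upwards [coeFn_toL2 (hE.memLp t), coeFn_lift_feedback τ γ θ φ (x (t - 1)),
      Lp.coeFn_sub (x t) (x (t - 1)), Lp.coeFn_add
        (lift μ (sandwich τ φᵀ) (lift μ (sandwich γᵀ θ) (x (t - 1)))) (toL2 _ (hE.memLp t))]
      with ω h1 h2 h3 h4
    rw [ht, h4, Pi.add_apply, Pi.sub_apply] at h3
    rw [← h1, ← h2, of_add_of, of_sub_of, h3]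
  · obtain ⟨R, hR⟩ := hR
    refine ⟨R.toNNReal, fun t _ i j => ?_⟩
    refine (eLpNorm_congr_ae ?_).trans_le ((eLpNorm_entry_le (x t - x (t - 1)) i j).trans ?_)
    · filter_upwards [Lp.coeFn_sub (x t) (x (t - 1))] with ω h
      rw [h]; rfl
    · rw [← ofReal_norm]
      exact ENNReal.ofReal_le_ofReal (hR t)

theorem IsStartedMECM.memLp (hE : IsWhiteNoise μ E S) {X : ℕ → Ω → Matrix (Fin m) (Fin n) ℝ}
    (hX : IsStartedMECM μ τ γ θ φ E X) (t : ℕ) : ∀ i j, MemLp (fun ω => X t ω i j) 2 μ := by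
  induction t with
  | zero => exact hX.memLp_zero
  | succ t ih =>
    intro i j
    refine (((ih i j).add (memLp_sandwich ih (τ * γᵀ) (θ * φᵀ) i j)).add
      (hE.memLp (t + 1) i j)).ae_eq ?_
    filter_upwards [hX.eqn t] with ω h
    rw [sub_eq_iff_eq_add.1 h]
    simp only [Pi.add_apply, Matrix.add_apply, Matrix.mul_assoc]
    ring

theorem IsStartedMECM.solvesECM (hE : IsWhiteNoise μ E S) {X : ℕ → Ω → Matrix (Fin m) (Fin n) ℝ}
    (hX : IsStartedMECM μ τ γ θ φ E X) (t : ℕ) :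
    toL2 (X (t + 1)) (hX.memLp hE (t + 1)) - toL2 (X t) (hX.memLp hE t)
      = lift μ (sandwich τ φᵀ) (lift μ (sandwich γᵀ θ) (toL2 (X t) (hX.memLp hE t)))
        + toL2 (E (t + 1)) (hE.memLp (t + 1)) := by
  apply Lp.ext
  filter_upwards [hX.eqn t, coeFn_toL2 (hE.memLp (t + 1)), coeFn_toL2 (hX.memLp hE (t + 1)),
    coeFn_toL2 (hX.memLp hE t), coeFn_lift_feedback τ γ θ φ (toL2 _ (hX.memLp hE t)),
    Lp.coeFn_sub (toL2 _ (hX.memLp hE (t + 1))) (toL2 _ (hX.memLp hE t)),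
    Lp.coeFn_add (lift μ (sandwich τ φᵀ) (lift μ (sandwich γᵀ θ) (toL2 _ (hX.memLp hE t))))
      (toL2 _ (hE.memLp (t + 1)))] with ω h1 h2 h3 h4 h5 h6 h7
  rw [h6, h7]
  apply of.injective
  rw [Pi.sub_apply, Pi.add_apply, ← of_sub_of, ← of_add_of, h2, h3, h4, h5, h4, h1]

/-- A one-sided process `A X_t B` that sees the common trends is `I(1)` and not `I(0)`. -/
theorem IsMECM.isI1_and_not_isI0 [IsProbabilityMeasure μ] (hE : IsWhiteNoise μ E S) (hS : S.PosDef)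
    {T : (Fin r₁ → Fin r₂ → ℝ) →L[ℝ] (Fin r₁ → Fin r₂ → ℝ)}
    (hT : StableFactor (sandwich τ φᵀ) (sandwich γᵀ θ) T) (hX : IsMECM μ τ γ θ φ E X) {p q : ℕ}
    (A : Matrix (Fin p) (Fin m) ℝ) (B : Matrix (Fin n) (Fin q) ℝ) {v : Matrix (Fin m) (Fin n) ℝ}
    (hv : γᵀ * v * θ = 0) (hAB : A * v * B ≠ 0) :
    IsI1 μ (fun t ω => A * X t ω * B) ∧ ¬ IsI0 μ (fun t ω => A * X t ω * B) := by
  have hWN := hE.isLpWhite hS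
  obtain ⟨c, hc⟩ := hWN.bdd
  obtain ⟨R, hR⟩ := hX.exists_norm_past_le
  have hsol := hX.solvesECM hE
  have hmem : ∀ t i j, MemLp (fun ω => (A * X t ω * B) i j) 2 μ :=
    fun t => memLp_sandwich (hX.memLp t) A B
  have hWv : sandwich γᵀ θ (of.symm v) = 0 := of.injective hv
  have hLv : sandwich A B (of.symm v) ≠ 0 := fun h => hAB (congrArg of h)
  constructor
  · have hmem' : ∀ t i j, MemLp (fun ω => (A * X t ω * B - A * X (t - 1) ω * B) i j) 2 μ :=
      fun t i j => (hmem t i j).sub (hmem (t - 1) i j)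
    refine isI0_of_hasSum hE hS hmem' (hT.exists_norm_diffCoeff_le (sandwich A B))
      ⟨of.symm v, _, hT.hasSum_diffCoeff (sandwich A B) (of.symm v), ?_⟩ fun t => ?_
    -- As `W v = 0`, the coefficient sum at `v` reduces to `A v B`.
    · rwa [hWv, map_zero, map_zero, map_zero, sub_zero]
    · have h1 := hT.lift.hasSum_diff hc hsol hR (lift μ (sandwich A B)) t
      simp only [lift_diffCoeff] at h1
      rw [toL2_sub (hmem t) (hmem (t - 1)) (hmem' t), ← lift_sandwich_toL2 (hX.memLp t),
        ← lift_sandwich_toL2 (hX.memLp (t - 1)), ← map_sub]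
      exact h1
  -- An `I(0)` process is bounded in mean square, so every entry of `A x B` would have to vanish on
  -- `ker W`, which contains `v`.
  · intro h0
    obtain ⟨R', hR'⟩ := h0.exists_norm_le hmem
    obtain ⟨K, hK⟩ := hT.lift.exists_norm_map_le hc hsol hR
    apply hLv
    ext i j
    refine hT.eq_zero_of_bounded hWN hsol hK (entry i j ∘L sandwich A B)
      (R := ‖lift μ (entry i j : (Fin p → Fin q → ℝ) →L[ℝ] ℝ)‖ * R') (fun t => ?_) hWv
    rw [lift_comp, lift_sandwich_toL2]
    exact (ContinuousLinearMap.le_opNorm _ _).trans (by gcongr; exact hR' t)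

theorem IsMECM.hasSum_bilinear [IsProbabilityMeasure μ] (hE : IsWhiteNoise μ E S) (hS : S.PosDef)
    {T : (Fin r₁ → Fin r₂ → ℝ) →L[ℝ] (Fin r₁ → Fin r₂ → ℝ)}
    (hT : StableFactor (sandwich τ φᵀ) (sandwich γᵀ θ) T) (hX : IsMECM μ τ γ θ φ E X) (t : ℤ) :
    HasSum (fun l : ℕ => lift μ (((1 + sandwich γᵀ θ ∘L sandwich τ φᵀ) ^ l) ∘L sandwich γᵀ θ)
      (toL2 (E (t - l)) (hE.memLp (t - l))))
      (toL2 (fun ω => γᵀ * X t ω * θ) (memLp_sandwich (hX.memLp t) γᵀ θ)) := by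
  obtain ⟨c, hc⟩ := (hE.isLpWhite hS).bdd
  obtain ⟨R, hR⟩ := hX.exists_norm_past_le
  have h1 := hT.lift.hasSum_map hc (hX.solvesECM hE) hR t
  simp only [lift_coeff] at h1
  rwa [lift_sandwich_toL2] at h1

/-- The functional `X ↦ tr(B'X)`, as a `1 × 1` array. -/
noncomputable def traceMap {a b : ℕ} (B : Matrix (Fin a) (Fin b) ℝ) :
    (Fin a → Fin b → ℝ) →L[ℝ] (Fin 1 → Fin 1 → ℝ) :=
  LinearMap.toContinuousLinearMap
    { toFun := fun X _ _ => (Bᵀ * of X).trace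
      map_add' := fun X Y => by
        ext; rw [← of_add_of, Matrix.mul_add, trace_add]; rfl
      map_smul' := fun r X => by
        ext; rw [← smul_of, Matrix.mul_smul, trace_smul]; rfl }

theorem of_traceMap {a b : ℕ} (B : Matrix (Fin a) (Fin b) ℝ) (X : Fin a → Fin b → ℝ) :
    of (traceMap B X) = !![(Bᵀ * of X).trace] := by
  ext i j
  fin_cases i; fin_cases j; rfl

theorem memLp_trace {a b : ℕ} (B : Matrix (Fin a) (Fin b) ℝ) {X : Ω → Matrix (Fin a) (Fin b) ℝ}
    (hX : ∀ i j, MemLp (fun ω => X ω i j) 2 μ) (i j : Fin 1) :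
    MemLp (fun ω => !![(Bᵀ * X ω).trace] i j) 2 μ := by
  have := (entry i j ∘L traceMap B).comp_memLp' (memLp_array hX)
  fin_cases i; fin_cases j; exact this

theorem lift_traceMap_toL2 {a b : ℕ} (B : Matrix (Fin a) (Fin b) ℝ)
    {X : Ω → Matrix (Fin a) (Fin b) ℝ} (hX : ∀ i j, MemLp (fun ω => X ω i j) 2 μ) :
    lift μ (traceMap B) (toL2 X hX) = toL2 (fun ω => !![(Bᵀ * X ω).trace]) (memLp_trace B hX) := by
  apply Lp.ext
  filter_upwards [(traceMap B).coeFn_compLpL (p := 2) (toL2 X hX), coeFn_toL2 hX,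
    coeFn_toL2 (memLp_trace B hX)] with ω h1 h2 h3
  apply of.injective
  rw [h1, h3, of_traceMap, h2]

/-- Constant variances and constant means together make the second moments constant. -/
theorem IsWeaklyStationary.exists_norm_le [IsProbabilityMeasure μ] {p q : ℕ}
    {Y : ℤ → Ω → Matrix (Fin p) (Fin q) ℝ} (h : IsWeaklyStationary μ Y) :
    ∃ R, ∀ t, ‖toL2 (Y t) (h.memLp t)‖ ≤ R := by
  have hsq : ∀ t i j, ‖lift μ (entry i j) (toL2 (Y t) (h.memLp t))‖ ^ 2
      = ‖lift μ (entry i j) (toL2 (Y 0) (h.memLp 0))‖ ^ 2 := by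
    intro t i j
    have h1 := h.cov 0 0 t i j i j
    have h2 := h.mean 0 t i j
    rw [covariance_eq_sub (h.memLp _ _ _) (h.memLp _ _ _),
      covariance_eq_sub (h.memLp _ _ _) (h.memLp _ _ _), h2] at h1
    simp only [zero_add] at h1
    rw [← real_inner_self_eq_norm_sq, ← real_inner_self_eq_norm_sq, inner_lift_entry_toL2,
      inner_lift_entry_toL2]
    exact sub_left_injective h1
  obtain ⟨D, hD⟩ := exists_forall_le fun (i : Fin p) (j : Fin q) =>
    ‖lift μ (entry i j) (toL2 (Y 0) (h.memLp 0))‖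
  obtain ⟨R, hR⟩ := exists_norm_le_of_entry_le μ p q D
  refine ⟨R, fun t => hR _ fun i j => ?_⟩
  have h1 := (sq_eq_sq₀ (norm_nonneg _) (norm_nonneg _)).1 (hsq t i j)
  exact h1.trans_le (hD i j)

/-- A matrix orthogonal to the kernel of `x ↦ γ'xθ` has the form `γCθ'`. -/
theorem exists_eq_of_traceMap_eq_zero {P : Matrix (Fin r₁) (Fin r₁) ℝ}
    {Q : Matrix (Fin r₂) (Fin r₂) ℝ}
    (hT : StableFactor (sandwich τ φᵀ) (sandwich γᵀ θ) (sandwich P Q)) (B : Matrix (Fin m) (Fin n) ℝ)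
    (h : ∀ v, sandwich γᵀ θ v = 0 → traceMap B v = 0) :
    ∃ C : Matrix (Fin r₁) (Fin r₂) ℝ, B = γ * C * θᵀ := by
  -- `x - U T W x` lies in `ker W`, so `tr(B'x) = tr(B' U T W x)`; moving the factors right of `x`
  -- to the front by cyclicity shows `B' = θC'γ'` with this `C`.
  refine ⟨(Q * φᵀ * Bᵀ * τ * P)ᵀ, ?_⟩
  apply transpose_injective
  rw [transpose_mul, transpose_mul, transpose_transpose, transpose_transpose,
    ext_iff_trace_mul_right]
  intro x
  have h1 := h (of.symm x - sandwich τ φᵀ (sandwich P Q (sandwich γᵀ θ (of.symm x))))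
    (by rw [map_sub, hT.right, sub_self])
  rw [map_sub, sub_eq_zero] at h1
  have h2 : (Bᵀ * x).trace = (Bᵀ * (τ * (P * (γᵀ * x * θ) * Q) * φᵀ)).trace :=
    congrFun (congrFun h1 0) 0
  rw [h2]
  have h3 : Bᵀ * (τ * (P * (γᵀ * x * θ) * Q) * φᵀ) = (Bᵀ * τ * P * γᵀ * x) * (θ * Q * φᵀ) := by
    simp only [Matrix.mul_assoc]
  rw [h3, trace_mul_comm]
  simp only [Matrix.mul_assoc]

theorem IsMECM.isWeaklyStationary_trace_iff [IsProbabilityMeasure μ] (hE : IsWhiteNoise μ E S)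
    (hS : S.PosDef) {P : Matrix (Fin r₁) (Fin r₁) ℝ} {Q : Matrix (Fin r₂) (Fin r₂) ℝ}
    (hT : StableFactor (sandwich τ φᵀ) (sandwich γᵀ θ) (sandwich P Q))
    (hX : IsMECM μ τ γ θ φ E X) (B : Matrix (Fin m) (Fin n) ℝ) :
    IsWeaklyStationary μ (fun t ω => !![(Bᵀ * X t ω).trace]) ↔
      ∃ C : Matrix (Fin r₁) (Fin r₂) ℝ, B = γ * C * θᵀ := by
  constructor
  · intro h
    have hWN := hE.isLpWhite hS
    obtain ⟨c, hc⟩ := hWN.bdd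
    obtain ⟨R, hR⟩ := hX.exists_norm_past_le
    have hsol := hX.solvesECM hE
    obtain ⟨K, hK⟩ := hT.lift.exists_norm_map_le hc hsol hR
    obtain ⟨R', hR'⟩ := h.exists_norm_le
    refine exists_eq_of_traceMap_eq_zero hT B fun v hv => ?_
    ext i j
    refine hT.eq_zero_of_bounded hWN hsol hK (entry i j ∘L traceMap B)
      (R := ‖lift μ (entry i j : (Fin 1 → Fin 1 → ℝ) →L[ℝ] ℝ)‖ * R') (fun t => ?_) hv
    rw [lift_comp, lift_traceMap_toL2]
    exact (ContinuousLinearMap.le_opNorm _ _).trans (by gcongr; exact hR' t)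
  · rintro ⟨C, rfl⟩
    have heq : ∀ x : Matrix (Fin m) (Fin n) ℝ,
        ((γ * C * θᵀ)ᵀ * x).trace = (Cᵀ * (γᵀ * x * θ)).trace := fun x => by
      rw [transpose_mul, transpose_mul, transpose_transpose, Matrix.mul_assoc, trace_mul_comm]
      simp only [Matrix.mul_assoc]
    simp only [heq]
    refine isWeaklyStationary_of_hasSum hE hS
      (fun t => memLp_trace C (memLp_sandwich (hX.memLp t) γᵀ θ))
      (C := fun l => traceMap C ∘L
        (((1 + sandwich γᵀ θ ∘L sandwich τ φᵀ) ^ l) ∘L sandwich γᵀ θ)) fun t => ?_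
    have h1 := (hX.hasSum_bilinear hE hS hT t).mapL (lift μ (traceMap C))
    simp only [← lift_comp] at h1
    rwa [lift_traceMap_toL2] at h1

end Solutions

/-! ### The main theorem -/

theorem mainTheorem5 {Ω : Type*} [MeasurableSpace Ω] (μ : Measure Ω) [IsProbabilityMeasure μ]
    {m n r₁ r₂ : ℕ} (hr₁ : 0 < r₁) (hr₁m : r₁ < m) (hr₂ : 0 < r₂) (hr₂n : r₂ < n)
    (τ γ : Matrix (Fin m) (Fin r₁) ℝ) (θ φ : Matrix (Fin n) (Fin r₂) ℝ)
    (hτ : τ.rank = r₁) (hγ : γ.rank = r₁) (hθ : θ.rank = r₂) (hφ : φ.rank = r₂)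
    (hroot : RootCondition τ γ θ φ) (hsemi : SemisimpleUnitRoot τ γ θ φ)
    (E : ℤ → Ω → Matrix (Fin m) (Fin n) ℝ)
    (S : Matrix (Fin m × Fin n) (Fin m × Fin n) ℝ)
    (hE : IsWhiteNoise μ E S) (hS : S.PosDef) :
    (∀ X : ℤ → Ω → Matrix (Fin m) (Fin n) ℝ, IsMECM μ τ γ θ φ E X →
      IsI1 μ (fun t ω => γᵀ * X t ω) ∧ ¬ IsI0 μ (fun t ω => γᵀ * X t ω) ∧
      IsI1 μ (fun t ω => X t ω * θ) ∧ ¬ IsI0 μ (fun t ω => X t ω * θ) ∧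
      IsI0 μ (fun t ω => γᵀ * X t ω * θ) ∧
      IsWeaklyStationary μ (fun t ω => γᵀ * X t ω * θ) ∧
      ∀ B : Matrix (Fin m) (Fin n) ℝ,
        IsWeaklyStationary μ (fun t ω => !![(Bᵀ * X t ω).trace]) ↔
          ∃ C : Matrix (Fin r₁) (Fin r₂) ℝ, B = γ * C * θᵀ) ∧
    (∀ X : ℕ → Ω → Matrix (Fin m) (Fin n) ℝ, IsStartedMECM μ τ γ θ φ E X →
      ∃ Z : ℤ → Ω → Matrix (Fin m) (Fin n) ℝ, IsMECM μ τ γ θ φ E Z ∧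
        ∀ i j, Tendsto (fun t : ℕ => eLpNorm (fun ω => (X t ω - Z (t : ℤ) ω) i j) 2 μ)
          atTop (𝓝 0)) := by
  have hT := stableFactor_mecm hr₁ hr₂ hτ hγ hθ hφ hroot hsemi
  obtain ⟨Lγ, hLγ⟩ := exists_left_inverse_of_rank_eq γ hγ
  obtain ⟨Lθ, hLθ⟩ := exists_left_inverse_of_rank_eq θ hθ
  have hLγ' : γᵀ * Lγᵀ = 1 := by rw [← transpose_mul, hLγ, transpose_one]
  refine ⟨fun X hX => ?_, fun X hX => ?_⟩
  · have hleft : IsI1 μ (fun t ω => γᵀ * X t ω) ∧ ¬ IsI0 μ (fun t ω => γᵀ * X t ω) := by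
      -- A common trend visible to `γ'x`: with `u'θ = 0`, the lift `v` of `w = 1u'` through `γ'` has
      -- `γ'v = w ≠ 0` but `γ'vθ = 0`.
      obtain ⟨u, hu, hu0⟩ := exists_ne_zero_transpose_mulVec_eq_zero hr₂n θ
      obtain ⟨w, hw⟩ : ∃ w : Matrix (Fin r₁) (Fin n) ℝ, w = vecMulVec 1 u := ⟨_, rfl⟩
      have h1 : γᵀ * (Lγᵀ * w) = w := by rw [← Matrix.mul_assoc, hLγ', Matrix.one_mul]
      have h2 := hX.isI1_and_not_isI0 hE hS hT γᵀ (1 : Matrix (Fin n) (Fin n) ℝ) (v := Lγᵀ * w)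
        (by rw [h1, hw, vecMulVec_mul, ← mulVec_transpose, hu0]; ext; simp [vecMulVec_apply])
        (by
          rw [h1, Matrix.mul_one, hw]
          intro h
          exact hu (funext fun i => by
            simpa [vecMulVec_apply] using congrFun (congrFun h ⟨0, hr₁⟩) i))
      simpa only [Matrix.mul_one] using h2
    have hright : IsI1 μ (fun t ω => X t ω * θ) ∧ ¬ IsI0 μ (fun t ω => X t ω * θ) := by
      obtain ⟨u, hu, hu0⟩ := exists_ne_zero_transpose_mulVec_eq_zero hr₁m γ
      obtain ⟨w, hw⟩ : ∃ w : Matrix (Fin m) (Fin r₂) ℝ, w = vecMulVec u 1 := ⟨_, rfl⟩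
      have h1 : w * Lθ * θ = w := by rw [Matrix.mul_assoc, hLθ, Matrix.mul_one]
      have h2 := hX.isI1_and_not_isI0 hE hS hT (1 : Matrix (Fin m) (Fin m) ℝ) θ (v := w * Lθ)
        (by rw [Matrix.mul_assoc, h1, hw, mul_vecMulVec, hu0]; ext; simp [vecMulVec_apply])
        (by
          rw [Matrix.one_mul, h1, hw]
          intro h
          exact hu (funext fun i => by
            simpa [vecMulVec_apply] using congrFun (congrFun h i) ⟨0, hr₂⟩))
      simpa only [Matrix.one_mul] using h2
    refine ⟨hleft.1, hleft.2, hright.1, hright.2, ?_, ?_,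
      hX.isWeaklyStationary_trace_iff hE hS hT⟩
    · refine isI0_of_hasSum hE hS (fun t => memLp_sandwich (hX.memLp t) γᵀ θ)
        hT.exists_norm_coeff_le ?_ (hX.hasSum_bilinear hE hS hT)
      -- The coefficient sum is `-T W`. Since `W` is onto and `T` injective, a preimage of any
      -- nonzero matrix, here the all-ones one, shows that the sum is not zero.
      obtain ⟨w, hw⟩ : ∃ w : Matrix (Fin r₁) (Fin r₂) ℝ, w = vecMulVec 1 1 := ⟨_, rfl⟩
      refine ⟨of.symm (Lγᵀ * w * Lθ), _, hT.hasSum_pow _, ?_⟩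
      intro h
      rw [neg_eq_zero] at h
      have h1 : sandwich γᵀ θ (of.symm (Lγᵀ * w * Lθ)) = 0 := by
        rw [← hT.right (sandwich γᵀ θ (of.symm (Lγᵀ * w * Lθ)))]
        exact (congrArg (fun c => sandwich γᵀ θ (sandwich τ φᵀ c)) h).trans
          (by simp only [map_zero])
      have h2 : γᵀ * (Lγᵀ * w * Lθ) * θ = 0 := congrArg of h1
      have h3 : γᵀ * (Lγᵀ * w * Lθ) * θ = (γᵀ * Lγᵀ) * w * (Lθ * θ) := by
        simp only [Matrix.mul_assoc]
      rw [h3, hLγ', hLθ, Matrix.one_mul, Matrix.mul_one, hw] at h2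
      simpa [vecMulVec_apply] using congrFun (congrFun h2 ⟨0, hr₁⟩) ⟨0, hr₂⟩
    · exact isWeaklyStationary_of_hasSum hE hS (fun t => memLp_sandwich (hX.memLp t) γᵀ θ)
        (hX.hasSum_bilinear hE hS hT)
  · obtain ⟨c, hc⟩ := (hE.isLpWhite hS).bdd
    -- The two-sided solution is chosen with the permanent component of `X 0`; only the decaying
    -- transitory part of the difference remains.
    obtain ⟨x, hx, hR, hx0⟩ := hT.lift.exists_solution hc (toL2 (X 0) (hX.memLp hE 0))
    refine ⟨_, exists_solution_of_lp hE hx hR, fun i j => ?_⟩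
    refine tendsto_eLpNorm_entry (hT.lift.tendsto_sub hx
      (y := fun t => toL2 (X t) (hX.memLp hE t)) (hX.solvesECM hE) hx0) (fun t => ?_) i j
    filter_upwards [coeFn_toL2 (hX.memLp hE t), Lp.coeFn_sub (toL2 _ (hX.memLp hE t)) (x t)]
      with ω h1 h2
    rw [h2, Pi.sub_apply, ← of_sub_of, h1]
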